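/- Let $T>0$, let $H$ be a separable real Hilbert space and $\mathcal L(H)$ the bounded operators on $H$ with the operator norm. Let $\alpha,\beta,\eta\in(0,1)$ with $\beta-\eta>0$ and $\alpha-\eta>0$. *Noise.* Let $W=(W(t))_{t\in[0,T]}$ be an $H$-valued zero-mean Gaussian process on a probability space $(\Omega,\mathcal F,\mathbb P)$ (that is, $(W(t_1),\dots,W(t_n))$ is Gaussian in $H^n$ for all $t_1,\dots,t_n\in[0,T]$) such that for almost every $\omega$ the path $t\mapsto W(t,\omega)$ is $\beta$-Hölder continuous on $[0,T]$. Let $Q_W(s,t)=\mathbb E[W(s)\otimes W(t)]\in\mathcal L(H)$, $s,t\in[0,T]$, be its covariance operator, where $(x\otimes y)g=\langle y,g\rangle x$. For $Q:[0,T]^2\to\mathcal L(H)$ write $\square_{(u,u'),(v,v')}Q=Q(v,v')-Q(u,v')-Q(v,u')+Q(u,u')$. Assume $Q_W\in\mathcal Q_\alpha$: there is a constant $C$ such that for $0\le s\le t\le T$, $0\le s'\le t'\le T$, $r\in[0,T]$, $$\|Q_W(t,r)-Q_W(s,r)\|\le C|t-s|^\alpha,\quad \|Q_W(r,t')-Q_W(r,s')\|\le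 C|t'-s'|^\alpha,\quad \|\square_{(s,s'),(t,t')}Q_W\|\le C(|t-s||t'-s'|)^\alpha .$$ *Kernel.* Let $K\in\mathcal K_\eta$, i.e. $K(t,s)\in\mathcal L(H)$ for $0\le s\le t\le T$ and there is a constant $C$ such that for all $0\le r\le s<t\le\tau\le T$ and $\theta,\nu\in[0,1]$, $$\|K(t,s)\|\le C|t-s|^{-\eta},\qquad \|K(t,s)-K(t,r)\|\le C|t-s|^{-\eta-\theta}|s-r|^\theta,\qquad \|K(\tau,s)-K(t,s)\|\le C|t-s|^{-\eta-\theta}|\tau-t|^\theta,$$ $$\|K(\tau,s)-K(\tau,r)-K(t,s)+K(t,r)\|\le C|t-s|^{-\nu-\theta-\eta}|\tau-t|^\theta|s-r|^\nu .$$ Then the following holds. 1. For every $\omega$ whose path $W(\cdot,\omega)$ is $\beta$-Hölder continuous on $[0,T]$ and all $0\le t\le\tau\le T$, the pathwise Volterra integral $$X^\tau(t,\omega)=\int_0^tK(\tau,s)\,dW(s,\omega):=\lim_{|\mathcal P|\to0}\sum_{[u,v]\in\mathcal P}K(\tau,u)\big(W(v,\omega)-W(u,\omega)\big)$$ exists in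 $H$, the limit being over all partitions $\mathcal P$ of $[0,t]$ as their mesh $|\mathcal P|$ tends to $0$. For all $0\le t\le\tau\le T$ and $0\le t'\le\tau'\le T$, with partitions $\mathcal P$ of $[0,t]$ and $\mathcal P'$ of $[0,t']$, the two-dimensional Volterra integral $$\int_0^t\!\int_0^{t'}K(\tau,r)\,d^2Q_W(r,r')\,K(\tau',r')^*:=\lim_{|\mathcal P|,|\mathcal P'|\to0}\ \sum_{[u,v]\in\mathcal P,\ [u',v']\in\mathcal P'}K(\tau,u)\,\square_{(u,u'),(v,v')}Q_W\,K(\tau',u')^*$$ exists in operator norm. 2. $t\mapsto X^t(t)$, $t\in[0,T]$, is an $H$-valued zero-mean Gaussian process. 3. For all $0\le t\le\tau\le T$, $X^\tau(t)$ is a zero-mean Gaussian random variable in $H$, and for every $f\in H$ $$\mathbb E\big[\exp(i\langle X^\tau(t),f\rangle)\big]=\exp\Big(-\tfrac12\Big\langle\int_0^t\!\int_0^tK(\tau,r)\,d^2Q_W(r,r')\,K(\tau,r')^*f,\,f\Big\rangle\Big).$$ 4. The covariance operators are the two-dimensional Volterra integrals: for all $0\le t\le\tau\le T$ and $0\le t'\le\tau'\le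 T$, $$\mathbb E\big[X^\tau(t)\otimes X^{\tau'}(t')\big]=\int_0^t\!\int_0^{t'}K(\tau,r)\,d^2Q_W(r,r')\,K(\tau',r')^*.$$ -/

import Mathlib

open MeasureTheory ProbabilityTheory Filter Set
open scoped NNReal Topology InnerProductSpace

noncomputable section

namespace GaussianVolterra

/-- A partition `a = pt 0 < pt 1 < ⋯ < pt n = b` of the interval `[a, b]`.
Only the values `pt 0, …, pt n` matter. -/
structure IntervalPartition (a b : ℝ) where
  n : ℕ
  pt : ℕ → ℝ
  pt_zero : pt 0 = a
  pt_last : pt n = b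
  pt_lt : ∀ i < n, pt i < pt (i + 1)

/-- The mesh size: the length of the longest interval of the partition. -/
def IntervalPartition.mesh {a b : ℝ} (P : IntervalPartition a b) : ℝ≥0 :=
  (Finset.range P.n).sup fun i => nndist (P.pt i) (P.pt (i + 1))

/-- The filter "mesh size tends to `0`" on the partitions of `[a, b]`. -/
def meshFilter (a b : ℝ) : Filter (IntervalPartition a b) :=
  comap IntervalPartition.mesh (𝓝 0)

section Integrals

variable {H : Type*} [NormedAddCommGroup H] [InnerProductSpace ℝ H]

/-- `K` is a Volterra kernel of order `η` on `{(t, s) | 0 ≤ s ≤ t ≤ T}`; it may be singular on the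
diagonal, where its values do not matter. All four estimates are weighted by the distance `t - s`
from the diagonal that is smallest among the points involved. -/
def IsVolterraKernel (T η : ℝ) (K : ℝ → ℝ → H →L[ℝ] H) : Prop :=
  ∃ C : ℝ, ∀ τ t s r : ℝ, 0 ≤ r → r ≤ s → s < t → t ≤ τ → τ ≤ T →
    ∀ θ ∈ Icc (0 : ℝ) 1, ∀ ν ∈ Icc (0 : ℝ) 1,
      ‖K t s‖ ≤ C * (t - s) ^ (-η) ∧
      ‖K t s - K t r‖ ≤ C * (t - s) ^ (-η - θ) * (s - r) ^ θ ∧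
      ‖K τ s - K t s‖ ≤ C * (t - s) ^ (-η - θ) * (τ - t) ^ θ ∧
      ‖K τ s - K τ r - K t s + K t r‖ ≤
        C * (t - s) ^ (-ν - θ - η) * (τ - t) ^ θ * (s - r) ^ ν

/-- The rectangular increment of `Q` over `[u, v] × [u', v']`. -/
def rectIncrement {E : Type*} [AddCommGroup E] (Q : ℝ → ℝ → E) (u u' v v' : ℝ) : E :=
  Q v v' - Q u v' - Q v u' + Q u u'

/-- `Q : [0, T]² → L(H)` belongs to the class of `α`-regular covariance operators: it is
`α`-Hölder in each variable, and its rectangular increments are bounded by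
`C (|t - s| |t' - s'|) ^ α`. -/
def IsRegularCovariance (T α : ℝ) (Q : ℝ → ℝ → H →L[ℝ] H) : Prop :=
  ∃ C : ℝ,
    (∀ t s t' : ℝ, 0 ≤ s → s ≤ t → t ≤ T → t' ∈ Icc 0 T →
      ‖Q t t' - Q s t'‖ ≤ C * (t - s) ^ α) ∧
    (∀ t t' s' : ℝ, t ∈ Icc 0 T → 0 ≤ s' → s' ≤ t' → t' ≤ T →
      ‖Q t t' - Q t s'‖ ≤ C * (t' - s') ^ α) ∧
    (∀ t s t' s' : ℝ, 0 ≤ s → s ≤ t → t ≤ T → 0 ≤ s' → s' ≤ t' → t' ≤ T →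
      ‖rectIncrement Q s s' t t'‖ ≤ C * ((t - s) * (t' - s')) ^ α)

/-- The Riemann sum `∑ K(τ, u) (w(v) - w(u))` over the intervals `[u, v]` of a partition
of `[0, t]`. -/
def volterraSum (K : ℝ → ℝ → H →L[ℝ] H) (w : ℝ → H) (τ t : ℝ) (P : IntervalPartition 0 t) : H :=
  ∑ i ∈ Finset.range P.n, K τ (P.pt i) (w (P.pt (i + 1)) - w (P.pt i))

/-- The pathwise Volterra integral `∫₀ᵗ K(τ, s) dw(s)`, the limit in `H` of the Riemann sums as
the mesh size tends to `0`. -/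
def volterraIntegral (K : ℝ → ℝ → H →L[ℝ] H) (w : ℝ → H) (τ t : ℝ) : H :=
  limUnder (meshFilter 0 t) (volterraSum K w τ t)

/-- The Riemann sum `∑ K(τ, u) □Q K(τ', u')^*` over the rectangles `[u, v] × [u', v']` of a
product of partitions of `[0, t]` and `[0, t']`; here `□Q` is the rectangular increment. -/
def volterraSum₂ [CompleteSpace H] (K Q : ℝ → ℝ → H →L[ℝ] H) (τ τ' t t' : ℝ)
    (P : IntervalPartition 0 t × IntervalPartition 0 t') : H →L[ℝ] H :=
  ∑ i ∈ Finset.range P.1.n, ∑ j ∈ Finset.range P.2.n,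
    K τ (P.1.pt i) ∘L
      rectIncrement Q (P.1.pt i) (P.2.pt j) (P.1.pt (i + 1)) (P.2.pt (j + 1)) ∘L
      ContinuousLinearMap.adjoint (K τ' (P.2.pt j))

/-- The two-dimensional Volterra integral `∫₀ᵗ ∫₀ᵗ' K(τ, r) d²Q(r, r') K(τ', r')^*`, the limit in
operator norm of the Riemann sums as both mesh sizes tend to `0`. -/
def volterraIntegral₂ [CompleteSpace H] (K Q : ℝ → ℝ → H →L[ℝ] H) (τ τ' t t' : ℝ) : H →L[ℝ] H :=
  limUnder (meshFilter 0 t ×ˢ meshFilter 0 t') (volterraSum₂ K Q τ τ' t t')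

/-- The covariance operator `E[X ⊗ Y]` of two zero-mean `H`-valued random variables, as a Bochner
integral in `L(H)`, where `(x ⊗ y) g = ⟨y, g⟩ x`. -/
def covarianceOp {Ω : Type*} [MeasurableSpace Ω] (P : Measure Ω) (X Y : Ω → H) : H →L[ℝ] H :=
  ∫ ω, InnerProductSpace.rankOne ℝ (X ω) (Y ω) ∂P

/-- The pathwise Volterra process `X^τ(t, ω) = ∫₀ᵗ K(τ, s) dW(s, ω)`. -/
def pathwiseVolterra {Ω : Type*} (K : ℝ → ℝ → H →L[ℝ] H) (W : ℝ → Ω → H) (τ t : ℝ) (ω : Ω) : H :=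
  volterraIntegral K (fun s => W s ω) τ t

end Integrals

end GaussianVolterra

end

/-!
The Volterra integrals are limits of Riemann sums with an integrand that is singular at the right
endpoint. The observation that removes the singularity is a change of clock: with
`φ s = -(t - s) ^ ρ` and `ρ = (γ - η) / (1 + γ)`, the defect of additivity of the increment
`k(u) (f(v) - f(u))` of a `γ`-Hölder function `f` against a kernel `k` of order `η < γ` is at most
a constant times `(φ b - φ a) ^ (1 + γ)` (`IsSingularIntegrand.norm_apply_le`). The exponent is
larger than `1`, so Young's argument (`norm_sum_Ico_sub_le`) applies as if there were no
singularity. It shows that Riemann sums are bounded and Cauchy in the mesh size, with bounds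
that are linear in the Hölder constant of `f` (`IsSingularIntegrand.exists_riemannSum_bounds`).

The two-dimensional Riemann sum is a one-dimensional Riemann sum of one-dimensional Riemann sums.
By linearity, the inner sums are Hölder continuous in the outer variable uniformly in the inner
partition, and so the one-dimensional bounds, used once in each variable, give convergence in
operator norm (`tendsto_volterraSum₂`).

For the probabilistic part, Riemann sums of `W` are jointly Gaussian and centred, and their
covariances are the two-dimensional Riemann sums of the covariance operator of `W`
(`integral_inner_volterraSum_mul_inner_volterraSum`), which converge. Hence the characteristic
functions of all linear functionals of the Riemann sums converge to Gaussian ones, and the almost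
sure limits are jointly Gaussian with the limiting covariances (`hasGaussianLaw_of_tendsto`,
`isGaussianProcess_pathwiseVolterra`). No uniform integrability argument is needed: second moments
of the limit are read off from its Gaussian law, mixed moments follow by polarization.
-/

namespace GaussianVolterra

/-! ### Young's estimate for Riemann sums of almost additive functions -/

/-- **Young's estimate.** If `Ξ` is additive up to the superadditive quantity
`M * (φ b - φ a) ^ p` with `p > 1`, then all Riemann sums of `Ξ` along weakly increasing points stay
close to its value on the whole interval, uniformly in the number of points. The constant `c` is
the fixed point of the recursion obtained by cutting out one interval such that both remaining
pieces carry at most half of the `φ`-length. -/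
theorem norm_sum_Ico_sub_le {E : Type*} [NormedAddCommGroup E] {Ξ : ℝ → ℝ → E} {φ : ℝ → ℝ}
    {lo hi M p : ℝ} (hM : 0 ≤ M) (hp : 1 < p) (hφ : MonotoneOn φ (Icc lo hi))
    (hΞ : ∀ a m b, lo ≤ a → a ≤ m → m ≤ b → b ≤ hi →
      ‖Ξ a b - Ξ a m - Ξ m b‖ ≤ M * (φ b - φ a) ^ p)
    (s : ℕ → ℝ) (i j : ℕ) (hij : i ≤ j)
    (hs : ∀ a b, i ≤ a → a ≤ b → b ≤ j → s a ≤ s b) (hlo : lo ≤ s i) (hhi : s j ≤ hi) :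
    ‖∑ k ∈ Finset.Ico i j, Ξ (s k) (s (k + 1)) - Ξ (s i) (s j)‖ ≤
      2 / (1 - 2 ^ (1 - p)) * M * (φ (s j) - φ (s i)) ^ p := by
  have hlt : (2 : ℝ) ^ (1 - p) < 1 := Real.rpow_lt_one_of_one_lt_of_neg one_lt_two (by linarith)
  set c : ℝ := 2 / (1 - 2 ^ (1 - p)) with hc_def
  have hc0 : 0 ≤ c := by rw [hc_def]; apply div_nonneg <;> linarith
  have hc : 2 + c * 2 ^ (1 - p) = c := by
    have : (1 : ℝ) - 2 ^ (1 - p) ≠ 0 := by linarith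
    rw [hc_def]; field_simp; ring
  have h0 : ∀ a, lo ≤ a → a ≤ hi → Ξ a a = 0 := by
    intro a h1 h2
    have := hΞ a a a h1 le_rfl le_rfl h2
    rw [sub_self, sub_self, Real.zero_rpow (by linarith), mul_zero] at this
    simpa using this
  have half_rpow : ∀ x : ℝ, 0 ≤ x → (x / 2) ^ p * 2 = 2 ^ (1 - p) * x ^ p := by
    intro x hx
    rw [Real.div_rpow hx (by norm_num), Real.rpow_sub (by norm_num), Real.rpow_one]
    ring
  induction hn : j - i using Nat.strong_induction_on generalizing i j with
  | _ n ih =>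
    have hmem : ∀ a, i ≤ a → a ≤ j → s a ∈ Icc lo hi := fun a h1 h2 =>
      ⟨hlo.trans (hs _ _ le_rfl h1 h2), (hs _ _ h1 h2 le_rfl).trans hhi⟩
    have hφm : ∀ a b, i ≤ a → a ≤ b → b ≤ j → φ (s a) ≤ φ (s b) := fun a b h1 h2 h3 =>
      hφ (hmem a h1 (h2.trans h3)) (hmem b (h1.trans h2) h3) (hs a b h1 h2 h3)
    rcases hij.eq_or_lt with rfl | hlt'
    · simp [h0 (s i) hlo hhi, Real.zero_rpow (show p ≠ 0 by linarith)]
    set w := φ (s j) - φ (s i) with hw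
    have hw0 : 0 ≤ w := sub_nonneg.2 (hφm i j le_rfl hij le_rfl)
    -- the last index `l < j` up to which at most half of the `φ`-length is used
    obtain ⟨l, hil, hlj, hl1, hl2⟩ : ∃ l, i ≤ l ∧ l < j ∧ φ (s l) - φ (s i) ≤ w / 2 ∧
        φ (s j) - φ (s (l + 1)) ≤ w / 2 := by
      classical
      let pr : ℕ → Prop := fun l => i ≤ l ∧ φ (s l) - φ (s i) ≤ w / 2
      have hpi : pr i := ⟨le_rfl, by rw [sub_self]; positivity⟩
      have hb : i ≤ j - 1 := by omega
      have h1 : pr (Nat.findGreatest pr (j - 1)) := Nat.findGreatest_spec hb hpi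
      have h2 : Nat.findGreatest pr (j - 1) ≤ j - 1 := Nat.findGreatest_le _
      refine ⟨_, h1.1, by omega, h1.2, ?_⟩
      set l := Nat.findGreatest pr (j - 1)
      rcases Nat.lt_or_ge (l + 1) j with h3 | h3
      · have h4 : ¬ pr (l + 1) := Nat.findGreatest_is_greatest (Nat.lt_succ_self l) (by omega)
        have h5 : w / 2 < φ (s (l + 1)) - φ (s i) := by
          by_contra hcon
          exact h4 ⟨h1.1.trans (Nat.le_succ l), not_lt.1 hcon⟩
        linarith
      · have : l + 1 = j := by omega
        rw [this, sub_self]; positivity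
    have e1 := ih (l - i) (by omega) i l hil (fun a b h1 h2 h3 => hs a b h1 h2 (h3.trans hlj.le))
      hlo (hmem l hil hlj.le).2 rfl
    have e2 := ih (j - (l + 1)) (by omega) (l + 1) j hlj
      (fun a b h1 h2 h3 => hs a b (by omega) h2 h3) (hmem (l + 1) (by omega) hlj).1 hhi rfl
    have d1 := hΞ (s i) (s (l + 1)) (s j) hlo (hs _ _ le_rfl (by omega) hlj)
      (hs _ _ (by omega) hlj le_rfl) hhi
    have d2 := hΞ (s i) (s l) (s (l + 1)) hlo (hs _ _ le_rfl hil hlj.le)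
      (hs _ _ hil (Nat.le_succ l) hlj) (hmem (l + 1) (by omega) hlj).2
    have d2' : M * (φ (s (l + 1)) - φ (s i)) ^ p ≤ M * w ^ p := by
      have := hφm i (l + 1) le_rfl (by omega) hlj
      have := hφm (l + 1) j (by omega) hlj le_rfl
      gcongr
      linarith
    have e1' : c * M * (φ (s l) - φ (s i)) ^ p ≤ c * M * (w / 2) ^ p := by
      have := hφm i l le_rfl hil hlj.le
      gcongr
    have e2' : c * M * (φ (s j) - φ (s (l + 1))) ^ p ≤ c * M * (w / 2) ^ p := by
      have := hφm (l + 1) j (by omega) hlj le_rfl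
      gcongr
    have hsum : ∑ k ∈ Finset.Ico i j, Ξ (s k) (s (k + 1)) =
        ∑ k ∈ Finset.Ico i l, Ξ (s k) (s (k + 1)) + Ξ (s l) (s (l + 1)) +
          ∑ k ∈ Finset.Ico (l + 1) j, Ξ (s k) (s (k + 1)) := by
      rw [← Finset.sum_Ico_succ_top hil, Finset.sum_Ico_consecutive _ (by omega) (by omega)]
    have hdecomp : ∑ k ∈ Finset.Ico i j, Ξ (s k) (s (k + 1)) - Ξ (s i) (s j) =
        (∑ k ∈ Finset.Ico i l, Ξ (s k) (s (k + 1)) - Ξ (s i) (s l)) +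
        (∑ k ∈ Finset.Ico (l + 1) j, Ξ (s k) (s (k + 1)) - Ξ (s (l + 1)) (s j)) -
        (Ξ (s i) (s j) - Ξ (s i) (s (l + 1)) - Ξ (s (l + 1)) (s j)) -
        (Ξ (s i) (s (l + 1)) - Ξ (s i) (s l) - Ξ (s l) (s (l + 1))) := by
      rw [hsum]; abel
    rw [hdecomp]
    calc _ ≤ c * M * (w / 2) ^ p + c * M * (w / 2) ^ p + M * w ^ p + M * w ^ p := by
          refine (norm_sub_le _ _).trans (add_le_add ?_ (d2.trans d2'))
          refine (norm_sub_le _ _).trans (add_le_add ?_ d1)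
          exact (norm_add_le _ _).trans (add_le_add (e1.trans e1') (e2.trans e2'))
      _ = (2 + c * 2 ^ (1 - p)) * M * w ^ p := by
          linear_combination c * M * half_rpow w hw0
      _ = c * M * w ^ p := by rw [hc]

/-! ### Comparison of the Riemann sums of two partitions -/

namespace IntervalPartition

variable {a b : ℝ}

theorem pt_le_pt (P : IntervalPartition a b) {i j : ℕ} (hij : i ≤ j) (hj : j ≤ P.n) :
    P.pt i ≤ P.pt j := by
  induction j, hij using Nat.le_induction with
  | base => exact le_rfl
  | succ k _ ih => exact (ih (by omega)).trans (P.pt_lt k (by omega)).le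

theorem le_pt (P : IntervalPartition a b) {i : ℕ} (hi : i ≤ P.n) : a ≤ P.pt i :=
  P.pt_zero.symm.le.trans (P.pt_le_pt (Nat.zero_le i) hi)

theorem pt_le (P : IntervalPartition a b) {i : ℕ} (hi : i ≤ P.n) : P.pt i ≤ b :=
  (P.pt_le_pt hi le_rfl).trans P.pt_last.le

theorem pt_sub_pt_le_mesh (P : IntervalPartition a b) {i : ℕ} (hi : i < P.n) :
    P.pt (i + 1) - P.pt i ≤ P.mesh := by
  have h : nndist (P.pt i) (P.pt (i + 1)) ≤ P.mesh :=
    Finset.le_sup (f := fun i => nndist (P.pt i) (P.pt (i + 1))) (Finset.mem_range.2 hi)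
  have h' : dist (P.pt i) (P.pt (i + 1)) ≤ P.mesh := by exact_mod_cast h
  rw [Real.dist_eq, abs_sub_comm] at h'
  exact (le_abs_self _).trans h'

end IntervalPartition

/-- The value of `Ξ` on the intersection of `[u, v]` and `[u', v']`, and `0` if the interiors of
these intervals are disjoint. -/
noncomputable def interValue {E : Type*} [Zero E] (Ξ : ℝ → ℝ → E) (u v u' v' : ℝ) : E :=
  if max u u' < min v v' then Ξ (max u u') (min v v') else 0

theorem interValue_comm {E : Type*} [Zero E] (Ξ : ℝ → ℝ → E) (u v u' v' : ℝ) :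
    interValue Ξ u v u' v' = interValue Ξ u' v' u v := by
  simp only [interValue, max_comm u u', min_comm v v']

/-- Clipping the points `u', v'` to the interval `[u, v]` produces the intersection of the two
intervals, or a degenerate interval. -/
theorem apply_clip_eq_interValue {E : Type*} [Zero E] {Ξ : ℝ → ℝ → E} {u v u' v' : ℝ}
    (h0 : ∀ x, u ≤ x → x ≤ v → Ξ x x = 0) (huv : u ≤ v) (huv' : u' ≤ v') :
    Ξ (max u (min v u')) (max u (min v v')) = interValue Ξ u v u' v' := by
  unfold interValue
  split_ifs with h
  · rw [max_lt_iff, lt_min_iff, lt_min_iff] at h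
    rw [min_eq_right h.2.1.le, max_eq_right (le_min huv h.1.2.le)]
  · have : max u (min v u') = max u (min v v') := by
      rcases le_total v' u with h1 | h1
      · rw [max_eq_left ((min_le_right _ _).trans (huv'.trans h1)),
          max_eq_left ((min_le_right _ _).trans h1)]
      rcases le_total v u' with h2 | h2
      · rw [min_eq_left h2, min_eq_left (h2.trans huv')]
      have h3 : min v v' ≤ max u u' := not_lt.1 h
      rcases le_total v v' with h4 | h4
      · rw [min_eq_left h4] at h3 ⊢
        rw [min_eq_right h2, max_eq_right huv]
        exact le_antisymm (max_le huv h2) h3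
      · rw [min_eq_right h4] at h3 ⊢
        rw [min_eq_right h2, max_eq_right h1]
        exact le_antisymm (max_le h1 huv') h3
    rw [this]
    exact h0 _ (le_max_left _ _) (max_le huv (min_le_left _ _))

/-- Passing from the partition `P` to its common refinement with `R` changes a Riemann sum by at
most the sum of the errors in Young's estimate over the intervals of `P`. -/
theorem norm_sum_sub_sum_interValue_le {E : Type*} [NormedAddCommGroup E] {Ξ : ℝ → ℝ → E}
    {φ : ℝ → ℝ} {lo hi M q : ℝ} (hM : 0 ≤ M) (hq : 0 < q) (hφ : MonotoneOn φ (Icc lo hi))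
    (hΞ : ∀ a m b, lo ≤ a → a ≤ m → m ≤ b → b ≤ hi →
      ‖Ξ a b - Ξ a m - Ξ m b‖ ≤ M * (φ b - φ a) ^ (1 + q))
    (P R : IntervalPartition lo hi) {δ : ℝ}
    (hδ : ∀ i < P.n, φ (P.pt (i + 1)) - φ (P.pt i) ≤ δ) :
    ‖∑ i ∈ Finset.range P.n, Ξ (P.pt i) (P.pt (i + 1)) -
      ∑ i ∈ Finset.range P.n, ∑ j ∈ Finset.range R.n,
        interValue Ξ (P.pt i) (P.pt (i + 1)) (R.pt j) (R.pt (j + 1))‖ ≤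
      2 / (1 - 2 ^ (-q)) * M * (φ hi - φ lo) * δ ^ q := by
  have hp0 : (1 : ℝ) + q ≠ 0 := by linarith
  have hlt : (2 : ℝ) ^ (-q) < 1 := Real.rpow_lt_one_of_one_lt_of_neg one_lt_two (by linarith)
  set c : ℝ := 2 / (1 - 2 ^ (-q)) with hc
  have hc0 : 0 ≤ c := by rw [hc]; apply div_nonneg <;> linarith
  have h0 : ∀ a, lo ≤ a → a ≤ hi → Ξ a a = 0 := by
    intro a h1 h2
    have := hΞ a a a h1 le_rfl le_rfl h2
    rw [sub_self, sub_self, Real.zero_rpow hp0, mul_zero] at this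
    simpa using this
  rw [← Finset.sum_sub_distrib]
  have key : ∀ i ∈ Finset.range P.n, ‖Ξ (P.pt i) (P.pt (i + 1)) - ∑ j ∈ Finset.range R.n,
      interValue Ξ (P.pt i) (P.pt (i + 1)) (R.pt j) (R.pt (j + 1))‖ ≤
      c * M * δ ^ q * (φ (P.pt (i + 1)) - φ (P.pt i)) := by
    intro i hi'
    have hi := Finset.mem_range.1 hi'
    have hu := P.le_pt hi.le
    have hv := P.pt_le hi
    have huv := (P.pt_lt i hi).le
    set u := P.pt i
    set v := P.pt (i + 1)
    have hφuv : 0 ≤ φ v - φ u :=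
      sub_nonneg.2 (hφ ⟨hu, huv.trans hv⟩ ⟨hu.trans huv, hv⟩ huv)
    have hY := norm_sum_Ico_sub_le hM (by linarith : 1 < 1 + q) hφ hΞ
      (fun j => max u (min v (R.pt j))) 0 R.n (Nat.zero_le _)
      (fun a b _ hab hb => max_le_max le_rfl (min_le_min le_rfl (R.pt_le_pt hab hb)))
      (hu.trans (le_max_left _ _)) (max_le (huv.trans hv) ((min_le_left _ _).trans hv))
    have e0 : max u (min v (R.pt 0)) = u := by
      rw [R.pt_zero]; exact max_eq_left ((min_le_right _ _).trans hu)
    have e1 : max u (min v (R.pt R.n)) = v := by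
      rw [R.pt_last, min_eq_left hv, max_eq_right huv]
    rw [e0, e1, show (1 : ℝ) - (1 + q) = -q by ring, ← hc, Nat.Ico_zero_eq_range] at hY
    rw [norm_sub_rev]
    have hsum : ∑ j ∈ Finset.range R.n, interValue Ξ u v (R.pt j) (R.pt (j + 1)) =
        ∑ j ∈ Finset.range R.n, Ξ (max u (min v (R.pt j))) (max u (min v (R.pt (j + 1)))) :=
      Finset.sum_congr rfl fun j hj => (apply_clip_eq_interValue
        (fun x h1 h2 => h0 x (hu.trans h1) (h2.trans hv)) huv
        (R.pt_lt j (Finset.mem_range.1 hj)).le).symm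
    rw [hsum]
    refine hY.trans ?_
    rw [Real.rpow_add_of_nonneg hφuv zero_le_one hq.le, Real.rpow_one]
    calc c * M * ((φ v - φ u) * (φ v - φ u) ^ q) ≤ c * M * ((φ v - φ u) * δ ^ q) := by
          gcongr
          exact hδ i hi
      _ = _ := by ring
  calc _ ≤ ∑ i ∈ Finset.range P.n, c * M * δ ^ q * (φ (P.pt (i + 1)) - φ (P.pt i)) :=
        norm_sum_le_of_le _ key
    _ = c * M * (φ hi - φ lo) * δ ^ q := by
        rw [← Finset.mul_sum, Finset.sum_range_sub (fun i => φ (P.pt i)), P.pt_zero, P.pt_last]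
        ring

/-- The Riemann sums of an almost additive function along two partitions are close to each other,
since both are close to the Riemann sum along the common refinement. -/
theorem norm_sum_sub_sum_le {E : Type*} [NormedAddCommGroup E] {Ξ : ℝ → ℝ → E}
    {φ : ℝ → ℝ} {lo hi M q : ℝ} (hM : 0 ≤ M) (hq : 0 < q) (hφ : MonotoneOn φ (Icc lo hi))
    (hΞ : ∀ a m b, lo ≤ a → a ≤ m → m ≤ b → b ≤ hi →
      ‖Ξ a b - Ξ a m - Ξ m b‖ ≤ M * (φ b - φ a) ^ (1 + q))
    (P R : IntervalPartition lo hi) {δ ε : ℝ}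
    (hδ : ∀ i < P.n, φ (P.pt (i + 1)) - φ (P.pt i) ≤ δ)
    (hε : ∀ i < R.n, φ (R.pt (i + 1)) - φ (R.pt i) ≤ ε) :
    ‖∑ i ∈ Finset.range P.n, Ξ (P.pt i) (P.pt (i + 1)) -
      ∑ i ∈ Finset.range R.n, Ξ (R.pt i) (R.pt (i + 1))‖ ≤
      2 / (1 - 2 ^ (-q)) * M * (φ hi - φ lo) * (δ ^ q + ε ^ q) := by
  have h1 := norm_sum_sub_sum_interValue_le hM hq hφ hΞ P R hδ
  have h2 := norm_sum_sub_sum_interValue_le hM hq hφ hΞ R P hε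
  rw [Finset.sum_comm] at h2
  simp_rw [interValue_comm Ξ (R.pt _)] at h2
  rw [norm_sub_rev] at h2
  refine (norm_sub_le_norm_sub_add_norm_sub _ _ _).trans ((add_le_add h1 h2).trans ?_)
  rw [mul_add]

/-! ### Riemann sums with singular integrands -/

section SingularKernel

variable {E F : Type*} [NormedAddCommGroup E] [NormedSpace ℝ E] [NormedAddCommGroup F]
  [NormedSpace ℝ F]

/-- An operator-valued function `k` on `[0, t)` with a singularity of order `η` at `t`. Only the
exponents `0` and `1` of the increment estimates of a Volterra kernel are kept. -/
structure IsSingularIntegrand (C η t : ℝ) (k : ℝ → E →L[ℝ] F) : Prop where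
  norm_le : ∀ s, 0 ≤ s → s < t → ‖k s‖ ≤ C * (t - s) ^ (-η)
  norm_sub_le : ∀ r s, 0 ≤ r → r ≤ s → s < t → ‖k s - k r‖ ≤ C * (t - s) ^ (-η)
  norm_sub_le_mul : ∀ r s, 0 ≤ r → r ≤ s → s < t →
    ‖k s - k r‖ ≤ C * (t - s) ^ (-η - 1) * (s - r)

/-- `f` is Hölder continuous on `[0, t]` with exponent `γ` and constant `A`. -/
def HolderBound (A γ t : ℝ) (f : ℝ → E) : Prop :=
  ∀ r s, 0 ≤ r → r ≤ s → s ≤ t → ‖f s - f r‖ ≤ A * (s - r) ^ γ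

/-- The Riemann sum `∑ k(u) (f(v) - f(u))` over the intervals `[u, v]` of a partition. -/
def riemannSum (k : ℝ → E →L[ℝ] F) (f : ℝ → E) {a b : ℝ} (P : IntervalPartition a b) : F :=
  ∑ i ∈ Finset.range P.n, k (P.pt i) (f (P.pt (i + 1)) - f (P.pt i))

/-- The tangent line inequality for the concave function `x ↦ x ^ ρ`. -/
theorem mul_rpow_mul_sub_le_rpow_sub_rpow {p q ρ : ℝ} (hp : 0 < p) (hq : 0 ≤ q) (hρ0 : 0 ≤ ρ)
    (hρ1 : ρ ≤ 1) : ρ * p ^ (ρ - 1) * (p - q) ≤ p ^ ρ - q ^ ρ := by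
  have h := rpow_one_add_le_one_add_mul_self (s := q / p - 1)
    (by have : 0 ≤ q / p := by positivity
        linarith) hρ0 hρ1
  rw [add_sub_cancel, Real.div_rpow hq hp.le, div_le_iff₀ (by positivity)] at h
  rw [Real.rpow_sub_one hp.ne']
  have : ρ * (p ^ ρ / p) * (p - q) = ρ * (1 - q / p) * p ^ ρ := by field_simp
  rw [this]
  linarith

theorem rpow_sub_rpow_le {x y ρ : ℝ} (hx : 0 ≤ x) (hxy : x ≤ y) (hρ0 : 0 ≤ ρ) (hρ1 : ρ ≤ 1) :
    y ^ ρ - x ^ ρ ≤ (y - x) ^ ρ := by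
  lift x to ℝ≥0 using hx
  obtain ⟨z, rfl⟩ : ∃ z : ℝ≥0, y = x + z :=
    ⟨(y - x).toNNReal, by rw [Real.coe_toNNReal _ (sub_nonneg.2 hxy)]; ring⟩
  have := NNReal.rpow_add_le_add_rpow x z hρ0 hρ1
  have h2 : ((x : ℝ) + z) ^ ρ ≤ (x : ℝ) ^ ρ + (z : ℝ) ^ ρ := by exact_mod_cast this
  rw [add_sub_cancel_left]
  linarith

/-- The key estimate: measured with the increments of `s ↦ -(t - s) ^ ρ`, `ρ = (γ - η) / (1 + γ)`,
the defect of additivity of `k(u) (f(v) - f(u))` is of order `1 + γ > 1`, with no singularity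
left at `t`. -/
theorem IsSingularIntegrand.norm_apply_le {C η t γ A : ℝ} {k : ℝ → E →L[ℝ] F} {f : ℝ → E}
    (hk : IsSingularIntegrand C η t k) (hC : 0 ≤ C) (hη : 0 < η) (hγ : η < γ) (hA : 0 ≤ A)
    (hf : HolderBound A γ t f) {ρ : ℝ} (hρ : ρ = (γ - η) / (1 + γ)) {a m b : ℝ}
    (ha : 0 ≤ a) (ham : a ≤ m) (hmb : m ≤ b) (hb : b ≤ t) :
    ‖(k m - k a) (f b - f m)‖ ≤
      2 / ρ * (1 / ρ) ^ γ * C * A * ((t - a) ^ ρ - (t - b) ^ ρ) ^ (1 + γ) := by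
  have hγ0 : 0 < γ := hη.trans hγ
  have hρ0 : 0 < ρ := by rw [hρ]; apply div_pos <;> linarith
  have hρ1 : ρ ≤ 1 := by rw [hρ, div_le_one (by linarith)]; linarith
  have hρm : ρ * (1 + γ) = γ - η := by rw [hρ]; field_simp
  have hmono : ∀ x y, x ≤ y → y ≤ t → (t - y) ^ ρ ≤ (t - x) ^ ρ := fun x y h1 h2 =>
    Real.rpow_le_rpow (by linarith) (by linarith) hρ0.le
  have hR : 0 ≤ (t - a) ^ ρ - (t - b) ^ ρ := by
    linarith [hmono a b (ham.trans hmb) hb]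
  rcases hmb.eq_or_lt with rfl | hmb'
  · rw [sub_self, map_zero, norm_zero]; positivity
  -- rescale by the distance `d` of `m` from the singularity
  set d := t - m with hd
  have hd0 : 0 < d := by linarith
  set x := min (m - a) d with hx
  have hx0 : 0 ≤ x := le_min (by linarith) hd0.le
  set y := b - m with hy
  have hy0 : 0 ≤ y := by linarith
  have h1 : ‖k m - k a‖ ≤ C * d ^ (-η) * (x / d) := by
    rcases min_cases (m - a) d with ⟨h, -⟩ | ⟨h, -⟩
    · refine (hk.norm_sub_le_mul a m ha ham (by linarith)).trans_eq ?_
      rw [hx, h, Real.rpow_sub_one hd0.ne']; ring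
    · refine (hk.norm_sub_le a m ha ham (by linarith)).trans_eq ?_
      rw [hx, h, div_self hd0.ne', mul_one]
  have h2 : ‖f b - f m‖ ≤ A * y ^ γ := hf m b (ha.trans ham) hmb hb
  have w1 : ρ / 2 * d ^ (ρ - 1) * x ≤ (t - a) ^ ρ - (t - b) ^ ρ := by
    have e1 := mul_rpow_mul_sub_le_rpow_sub_rpow (p := d + x) (q := d) (by positivity) hd0.le
      hρ0.le hρ1
    rw [add_sub_cancel_left] at e1
    have e2 : (d + x) ^ ρ ≤ (t - a) ^ ρ :=
      Real.rpow_le_rpow (by positivity) (by linarith [min_le_left (m - a) d]) hρ0.le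
    have e3 : (2 * d) ^ (ρ - 1) ≤ (d + x) ^ (ρ - 1) :=
      Real.rpow_le_rpow_of_nonpos (by positivity) (by linarith [min_le_right (m - a) d])
        (by linarith)
    have e4 : (2 : ℝ)⁻¹ ≤ 2 ^ (ρ - 1) := by
      rw [← Real.rpow_neg_one]
      exact Real.rpow_le_rpow_of_exponent_le one_le_two (by linarith)
    rw [Real.mul_rpow zero_le_two hd0.le] at e3
    have e5 : 2⁻¹ * d ^ (ρ - 1) ≤ (d + x) ^ (ρ - 1) :=
      (mul_le_mul_of_nonneg_right e4 (by positivity)).trans e3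
    calc ρ / 2 * d ^ (ρ - 1) * x = ρ * (2⁻¹ * d ^ (ρ - 1)) * x := by ring
      _ ≤ ρ * (d + x) ^ (ρ - 1) * x := by gcongr
      _ ≤ (t - a) ^ ρ - d ^ ρ := by linarith
      _ ≤ _ := by linarith [hmono m b hmb hb]
  have w2 : ρ * d ^ (ρ - 1) * y ≤ (t - a) ^ ρ - (t - b) ^ ρ := by
    have e1 := mul_rpow_mul_sub_le_rpow_sub_rpow (p := d) (q := t - b) hd0 (by linarith)
      hρ0.le hρ1
    rw [show d - (t - b) = y by rw [hd, hy]; ring] at e1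
    linarith [hmono a m ham (by linarith)]
  set w := (t - a) ^ ρ - (t - b) ^ ρ with hw
  have hdρ : d ^ (ρ - 1) = d ^ ρ / d := Real.rpow_sub_one hd0.ne' ρ
  have v1 : x / d ≤ 2 / ρ * (w / d ^ ρ) := by
    rw [hdρ] at w1
    calc x / d = 2 / ρ * ((ρ / 2 * (d ^ ρ / d) * x) / d ^ ρ) := by field_simp
      _ ≤ _ := by gcongr
  have v2 : y / d ≤ 1 / ρ * (w / d ^ ρ) := by
    rw [hdρ] at w2
    calc y / d = 1 / ρ * ((ρ * (d ^ ρ / d) * y) / d ^ ρ) := by field_simp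
      _ ≤ _ := by gcongr
  have hpow : d ^ (-η) * d ^ γ = (d ^ ρ) ^ (1 + γ) := by
    rw [← Real.rpow_mul hd0.le, hρm, ← Real.rpow_add hd0]; ring_nf
  calc ‖(k m - k a) (f b - f m)‖ ≤ C * d ^ (-η) * (x / d) * (A * y ^ γ) :=
        (ContinuousLinearMap.le_opNorm _ _).trans (by gcongr)
    _ = C * A * (d ^ (-η) * d ^ γ) * ((x / d) * (y / d) ^ γ) := by
        rw [Real.div_rpow hy0 hd0.le]; field_simp
    _ ≤ C * A * (d ^ (-η) * d ^ γ) *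
          ((2 / ρ * (w / d ^ ρ)) * (1 / ρ * (w / d ^ ρ)) ^ γ) := by gcongr
    _ = 2 / ρ * (1 / ρ) ^ γ * C * A * ((d ^ ρ) ^ (1 + γ) * (w / d ^ ρ) ^ (1 + γ)) := by
        rw [hpow, Real.mul_rpow (by positivity) (by positivity),
          Real.rpow_add_of_nonneg (x := w / d ^ ρ) (by positivity) zero_le_one hγ0.le,
          Real.rpow_one]
        ring
    _ = _ := by
        rw [← Real.mul_rpow (by positivity) (by positivity), mul_div_cancel₀ _ (by positivity)]

/-- Riemann sums of a singular integrand against Hölder continuous functions of exponent `γ > η`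
are bounded, and Cauchy as the mesh size tends to `0`, uniformly over the Hölder functions with a
given Hölder constant. -/
theorem IsSingularIntegrand.exists_riemannSum_bounds {C η t γ : ℝ} {k : ℝ → E →L[ℝ] F}
    (hk : IsSingularIntegrand C η t k) (hC : 0 ≤ C) (hη : 0 < η) (hγ : η < γ) (ht : 0 ≤ t) :
    ∃ B δ : ℝ, 0 ≤ B ∧ 0 < δ ∧ ∀ (f : ℝ → E) (A : ℝ), 0 ≤ A → HolderBound A γ t f →
      (∀ P : IntervalPartition 0 t, ‖riemannSum k f P‖ ≤ B * A) ∧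
      ∀ P R : IntervalPartition 0 t, ‖riemannSum k f P - riemannSum k f R‖ ≤
        A * (B * (P.mesh : ℝ) ^ δ + B * (R.mesh : ℝ) ^ δ) := by
  have hγ0 : 0 < γ := hη.trans hγ
  set ρ := (γ - η) / (1 + γ) with hρ
  have hρ0 : 0 < ρ := by rw [hρ]; apply div_pos <;> linarith
  have hρ1 : ρ ≤ 1 := by rw [hρ, div_le_one (by linarith)]; linarith
  set D := 2 / ρ * (1 / ρ) ^ γ * C with hD
  have hD0 : 0 ≤ D := by positivity
  have hlt : (2 : ℝ) ^ (-γ) < 1 := Real.rpow_lt_one_of_one_lt_of_neg one_lt_two (by linarith)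
  set c : ℝ := 2 / (1 - 2 ^ (-γ)) with hc
  have hc0 : 0 ≤ c := by rw [hc]; apply div_nonneg <;> linarith
  set φ : ℝ → ℝ := fun s => -(t - s) ^ ρ with hφ
  have hmono : MonotoneOn φ (Icc 0 t) := fun a ha b hb hab =>
    neg_le_neg (Real.rpow_le_rpow (by linarith [hb.2]) (by linarith) hρ0.le)
  have hw : φ t - φ 0 = t ^ ρ := by simp [hφ, Real.zero_rpow hρ0.ne']
  set B₁ := c * D * (t ^ ρ) ^ (1 + γ) + C * t ^ (-η) * t ^ γ with hB₁
  set B₂ := c * D * t ^ ρ with hB₂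
  have hB₁0 : 0 ≤ B₁ := by positivity
  have hB₂0 : 0 ≤ B₂ := by positivity
  refine ⟨B₁ + B₂, ρ * γ, by positivity, by positivity, fun f A hA hf => ?_⟩
  have hΞ : ∀ a m b, 0 ≤ a → a ≤ m → m ≤ b → b ≤ t →
      ‖k a (f b - f a) - k a (f m - f a) - k m (f b - f m)‖ ≤
        D * A * (φ b - φ a) ^ (1 + γ) := by
    intro a m b ha ham hmb hb
    have e : k a (f b - f a) - k a (f m - f a) - k m (f b - f m) =
        -((k m - k a) (f b - f m)) := by
      simp only [map_sub, sub_apply]; abel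
    rw [e, norm_neg, show φ b - φ a = (t - a) ^ ρ - (t - b) ^ ρ by simp only [hφ]; ring]
    exact hk.norm_apply_le hC hη hγ hA hf hρ ha ham hmb hb
  constructor
  · intro P
    have h := norm_sum_Ico_sub_le (Ξ := fun u v => k u (f v - f u)) (mul_nonneg hD0 hA)
      (by linarith : 1 < 1 + γ) hmono hΞ P.pt 0 P.n (Nat.zero_le _)
      (fun a b _ hab hb => P.pt_le_pt hab hb) (P.le_pt (Nat.zero_le _)) (P.pt_le le_rfl)
    rw [P.pt_zero, P.pt_last, hw, Nat.Ico_zero_eq_range, show (1 : ℝ) - (1 + γ) = -γ by ring,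
      ← hc] at h
    have h3 : ‖k 0 (f t - f 0)‖ ≤ C * t ^ (-η) * (A * t ^ γ) := by
      rcases ht.eq_or_lt with rfl | ht'
      · simp only [sub_self, map_zero, norm_zero]; positivity
      · refine (ContinuousLinearMap.le_opNorm _ _).trans ?_
        have h4 := hk.norm_le 0 le_rfl ht'
        have h5 := hf 0 t le_rfl ht le_rfl
        rw [sub_zero] at h4 h5
        gcongr
    calc ‖riemannSum k f P‖ ≤ ‖riemannSum k f P - k 0 (f t - f 0)‖ + ‖k 0 (f t - f 0)‖ := by
          simpa using norm_add_le (riemannSum k f P - k 0 (f t - f 0)) (k 0 (f t - f 0))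
      _ ≤ c * (D * A) * (t ^ ρ) ^ (1 + γ) + C * t ^ (-η) * (A * t ^ γ) := add_le_add h h3
      _ = B₁ * A := by rw [hB₁]; ring
      _ ≤ (B₁ + B₂) * A := by gcongr; linarith
  · intro P R
    have hmesh : ∀ (Q : IntervalPartition 0 t), ∀ i < Q.n,
        φ (Q.pt (i + 1)) - φ (Q.pt i) ≤ (Q.mesh : ℝ) ^ ρ := by
      intro Q i hi
      have h1 := rpow_sub_rpow_le (x := t - Q.pt (i + 1)) (y := t - Q.pt i)
        (by linarith [Q.pt_le hi]) (by linarith [Q.pt_lt i hi]) hρ0.le hρ1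
      have h2 : (t - Q.pt i - (t - Q.pt (i + 1))) ^ ρ ≤ (Q.mesh : ℝ) ^ ρ :=
        Real.rpow_le_rpow (by linarith [Q.pt_lt i hi]) (by linarith [Q.pt_sub_pt_le_mesh hi])
          hρ0.le
      simp only [hφ]
      linarith
    have h := norm_sum_sub_sum_le (Ξ := fun u v => k u (f v - f u)) (mul_nonneg hD0 hA)
      hγ0 hmono hΞ P R (hmesh P) (hmesh R)
    rw [hw, ← hc, ← Real.rpow_mul (by positivity), ← Real.rpow_mul (by positivity)] at h
    refine h.trans ?_
    have h4 : B₂ ≤ B₁ + B₂ := by linarith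
    calc c * (D * A) * t ^ ρ * ((P.mesh : ℝ) ^ (ρ * γ) + (R.mesh : ℝ) ^ (ρ * γ))
        = A * (B₂ * (P.mesh : ℝ) ^ (ρ * γ) + B₂ * (R.mesh : ℝ) ^ (ρ * γ)) := by
          rw [hB₂]; ring
      _ ≤ _ := by gcongr

end SingularKernel

/-! ### Partitions of small mesh size -/

/-- The partition of `[0, t]` into `n + 1` intervals of equal length. The degenerate
interval `[0, 0]` has only the partition with no intervals. -/
noncomputable def uniformPartition (t : ℝ) (ht : 0 ≤ t) (n : ℕ) : IntervalPartition 0 t where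
  n := if t = 0 then 0 else n + 1
  pt i := i * (t / (n + 1))
  pt_zero := by simp
  pt_last := by
    split_ifs with h
    · simp [h]
    · push_cast; field_simp
  pt_lt i hi := by
    split_ifs at hi with h
    · simp at hi
    · have : 0 < t := lt_of_le_of_ne ht (Ne.symm h)
      gcongr
      simp

theorem tendsto_uniformPartition (t : ℝ) (ht : 0 ≤ t) :
    Tendsto (uniformPartition t ht) atTop (meshFilter 0 t) := by
  refine tendsto_comap_iff.2 ?_
  have hle : ∀ n, ((uniformPartition t ht n).mesh : ℝ) ≤ t * (1 / ((n : ℝ) + 1)) := by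
    intro n
    have h0 : 0 ≤ t * (1 / ((n : ℝ) + 1)) := by positivity
    rw [← Real.le_toNNReal_iff_coe_le h0]
    refine Finset.sup_le fun i _ => ?_
    rw [Real.le_toNNReal_iff_coe_le h0, coe_nndist, Real.dist_eq, abs_sub_comm]
    simp only [uniformPartition]
    push_cast
    rw [show ((i : ℝ) + 1) * (t / (n + 1)) - i * (t / (n + 1)) = t * (1 / ((n : ℝ) + 1)) by ring,
      abs_of_nonneg h0]
  rw [← NNReal.tendsto_coe]
  refine squeeze_zero (fun n => NNReal.coe_nonneg _) hle ?_
  simpa using tendsto_one_div_add_atTop_nhds_zero_nat.const_mul t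

theorem meshFilter_neBot {t : ℝ} (ht : 0 ≤ t) : (meshFilter 0 t).NeBot :=
  (tendsto_uniformPartition t ht).neBot

theorem tendsto_mesh_rpow {t B δ : ℝ} (hδ : 0 < δ) :
    Tendsto (fun P : IntervalPartition 0 t => B * (P.mesh : ℝ) ^ δ) (meshFilter 0 t) (𝓝 0) := by
  have h1 : Tendsto (fun P : IntervalPartition 0 t => (P.mesh : ℝ)) (meshFilter 0 t) (𝓝 0) := by
    have : Tendsto IntervalPartition.mesh (meshFilter 0 t) (𝓝 0) := tendsto_comap
    exact (NNReal.tendsto_coe (x := 0)).2 this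
  have h2 := (h1.rpow_const (p := δ) (Or.inr hδ.le)).const_mul B
  rwa [Real.zero_rpow hδ.ne', mul_zero] at h2

/-- A function into a complete space whose oscillation is controlled by a function tending to `0`
converges. -/
theorem tendsto_limUnder_of_norm_sub_le {ι E : Type*} [NormedAddCommGroup E] [CompleteSpace E]
    {l : Filter ι} [l.NeBot] {F : ι → E} {e : ι → ℝ} (he : Tendsto e l (𝓝 0))
    (h : ∀ a b, ‖F a - F b‖ ≤ e a + e b) : Tendsto F l (𝓝 (limUnder l F)) := by
  refine tendsto_nhds_limUnder (cauchy_map_iff_exists_tendsto.1 ?_)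
  rw [Metric.cauchy_iff]
  refine ⟨inferInstance, fun ε hε => ?_⟩
  refine ⟨F '' {a | e a < ε / 2}, image_mem_map (he.eventually_lt_const (by positivity)), ?_⟩
  rintro _ ⟨a, ha, rfl⟩ _ ⟨b, hb, rfl⟩
  rw [dist_eq_norm]
  simp only [mem_ofPred_eq] at ha hb
  linarith [h a b]

/-! ### Existence of the Volterra integrals -/

section Existence

variable {E F : Type*} [NormedAddCommGroup E] [NormedSpace ℝ E] [NormedAddCommGroup F]
  [NormedSpace ℝ F]

theorem IsSingularIntegrand.map {E' F' : Type*} [NormedAddCommGroup E'] [NormedSpace ℝ E']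
    [NormedAddCommGroup F'] [NormedSpace ℝ F'] {C η t : ℝ} {k : ℝ → E →L[ℝ] F}
    (hk : IsSingularIntegrand C η t k) (Φ : (E →L[ℝ] F) → E' →L[ℝ] F')
    (hΦ : ∀ A, ‖Φ A‖ ≤ ‖A‖) (hsub : ∀ A B, Φ A - Φ B = Φ (A - B)) :
    IsSingularIntegrand C η t (fun s => Φ (k s)) where
  norm_le s h0 h1 := (hΦ _).trans (hk.norm_le s h0 h1)
  norm_sub_le r s h0 h1 h2 := by
    rw [hsub]; exact (hΦ _).trans (hk.norm_sub_le r s h0 h1 h2)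
  norm_sub_le_mul r s h0 h1 h2 := by
    rw [hsub]; exact (hΦ _).trans (hk.norm_sub_le_mul r s h0 h1 h2)

theorem riemannSum_sub (k : ℝ → E →L[ℝ] F) (f g : ℝ → E) {a b : ℝ} (P : IntervalPartition a b) :
    riemannSum k (fun s => f s - g s) P = riemannSum k f P - riemannSum k g P := by
  simp only [riemannSum, ← Finset.sum_sub_distrib]
  refine Finset.sum_congr rfl fun i _ => ?_
  rw [← map_sub]
  congr 1
  abel

/-- The fibres of a Volterra kernel are singular integrands; for `t < τ` the singularity at `τ` is
dominated by one at `t`. -/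
theorem IsVolterraKernel.exists_isSingularIntegrand {H : Type*} [NormedAddCommGroup H]
    [InnerProductSpace ℝ H] {T η : ℝ} {K : ℝ → ℝ → H →L[ℝ] H} (hη : 0 < η)
    (hK : IsVolterraKernel T η K) :
    ∃ C, 0 ≤ C ∧ ∀ τ ∈ Icc (0 : ℝ) T, ∀ t ∈ Icc (0 : ℝ) τ, IsSingularIntegrand C η t (K τ) := by
  obtain ⟨C, hC⟩ := hK
  refine ⟨|C|, abs_nonneg C, fun τ hτ t ht => ?_⟩
  have hpow : ∀ s x : ℝ, s < t → x ≤ 0 → C * (τ - s) ^ x ≤ |C| * (t - s) ^ x := by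
    intro s x hs hx
    have h1 : (τ - s) ^ x ≤ (t - s) ^ x :=
      Real.rpow_le_rpow_of_nonpos (by linarith) (by linarith [ht.2]) hx
    have h2 : 0 ≤ (τ - s) ^ x := Real.rpow_nonneg (by linarith [ht.2]) _
    exact mul_le_mul (le_abs_self C) h1 h2 (abs_nonneg C)
  have z : (0 : ℝ) ∈ Icc (0 : ℝ) 1 := ⟨le_rfl, zero_le_one⟩
  have o : (1 : ℝ) ∈ Icc (0 : ℝ) 1 := ⟨zero_le_one, le_rfl⟩
  refine ⟨fun s h0 hs => ?_, fun r s h0 hrs hs => ?_, fun r s h0 hrs hs => ?_⟩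
  · have h := (hC τ τ s s h0 le_rfl (hs.trans_le ht.2) le_rfl hτ.2 0 z 0 z).1
    exact h.trans (hpow s _ hs (by linarith))
  · have h := (hC τ τ s r h0 hrs (hs.trans_le ht.2) le_rfl hτ.2 0 z 0 z).2.1
    rw [Real.rpow_zero, mul_one, sub_zero] at h
    exact h.trans (hpow s _ hs (by linarith))
  · have h := (hC τ τ s r h0 hrs (hs.trans_le ht.2) le_rfl hτ.2 1 o 0 z).2.1
    rw [Real.rpow_one] at h
    exact h.trans (mul_le_mul_of_nonneg_right (hpow s _ hs (by linarith)) (by linarith))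

variable {H : Type*} [NormedAddCommGroup H] [InnerProductSpace ℝ H] [CompleteSpace H]

/-- The pathwise Volterra integral against a Hölder continuous path of exponent `β > η` exists. -/
theorem tendsto_volterraSum {T η : ℝ} {β : ℝ≥0} {K : ℝ → ℝ → H →L[ℝ] H} (hη : 0 < η)
    (hβη : η < β) (hK : IsVolterraKernel T η K) {w : ℝ → H} {A : ℝ≥0}
    (hw : HolderOnWith A β w (Icc 0 T)) {τ t : ℝ} (hτ : τ ∈ Icc (0 : ℝ) T)
    (ht : t ∈ Icc (0 : ℝ) τ) :
    Tendsto (volterraSum K w τ t) (meshFilter 0 t) (𝓝 (volterraIntegral K w τ t)) := by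
  obtain ⟨C, hC, hk⟩ := hK.exists_isSingularIntegrand hη
  obtain ⟨B, δ, -, hδ, h⟩ := (hk τ hτ t ht).exists_riemannSum_bounds hC hη hβη ht.1
  have hw' : HolderBound A β t w := by
    intro r s h0 hrs hst
    have := hw.dist_le (x := s) (y := r) ⟨h0.trans hrs, hst.trans (ht.2.trans hτ.2)⟩
      ⟨h0, hrs.trans (hst.trans (ht.2.trans hτ.2))⟩
    rwa [dist_eq_norm, Real.dist_eq, abs_of_nonneg (sub_nonneg.2 hrs)] at this
  have := meshFilter_neBot ht.1
  have h0 := ((tendsto_mesh_rpow (t := t) (B := B) hδ).const_mul (A : ℝ))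
  rw [mul_zero] at h0
  refine tendsto_limUnder_of_norm_sub_le h0 fun P R => ?_
  rw [← mul_add]
  exact (h w A A.2 hw').2 P R

/-- The two-dimensional Riemann sum is an iterated one-dimensional one, with left multiplication by
`K(τ, u)` and right multiplication by `K(τ', u')^*` as integrands. -/
theorem volterraSum₂_eq_riemannSum (K Q : ℝ → ℝ → H →L[ℝ] H) (τ τ' t t' : ℝ)
    (P : IntervalPartition 0 t × IntervalPartition 0 t') :
    volterraSum₂ K Q τ τ' t t' P =
      riemannSum (fun u => ContinuousLinearMap.compL ℝ H H H (K τ u))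
        (fun s => riemannSum
          (fun u => (ContinuousLinearMap.compL ℝ H H H).flip (ContinuousLinearMap.adjoint (K τ' u)))
          (Q s) P.2) P.1 := by
  simp only [volterraSum₂, riemannSum]
  refine Finset.sum_congr rfl fun i _ => ?_
  rw [← Finset.sum_sub_distrib, map_sum]
  refine Finset.sum_congr rfl fun j _ => ?_
  rw [← map_sub]
  simp only [ContinuousLinearMap.flip_apply, ContinuousLinearMap.compL_apply, rectIncrement]
  congr 2
  abel

/-- The two-dimensional Volterra integral exists. The inner Riemann sums are Hölder continuous in
the outer variable, uniformly in the inner partition, so that the one-dimensional bounds apply in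
each variable in turn. -/
theorem tendsto_volterraSum₂ {T η α : ℝ} {K Q : ℝ → ℝ → H →L[ℝ] H} (hη : 0 < η)
    (hαη : η < α) (hK : IsVolterraKernel T η K) (hQ : IsRegularCovariance T α Q)
    {τ t τ' t' : ℝ} (hτ : τ ∈ Icc (0 : ℝ) T) (ht : t ∈ Icc (0 : ℝ) τ)
    (hτ' : τ' ∈ Icc (0 : ℝ) T) (ht' : t' ∈ Icc (0 : ℝ) τ') :
    Tendsto (volterraSum₂ K Q τ τ' t t') (meshFilter 0 t ×ˢ meshFilter 0 t')
      (𝓝 (volterraIntegral₂ K Q τ τ' t t')) := by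
  obtain ⟨C, hC, hk⟩ := hK.exists_isSingularIntegrand hη
  obtain ⟨D, -, -, hD⟩ := hQ
  have hkL : IsSingularIntegrand C η t (fun u => ContinuousLinearMap.compL ℝ H H H (K τ u)) :=
    (hk τ hτ t ht).map _
      (fun A => ContinuousLinearMap.opNorm_le_bound _ (norm_nonneg _)
        fun B => ContinuousLinearMap.opNorm_comp_le A B)
      (fun A B => (map_sub _ A B).symm)
  have hkR : IsSingularIntegrand C η t' (fun u =>
      (ContinuousLinearMap.compL ℝ H H H).flip (ContinuousLinearMap.adjoint (K τ' u))) := by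
    refine (hk τ' hτ' t' ht').map
      (fun A => (ContinuousLinearMap.compL ℝ H H H).flip (ContinuousLinearMap.adjoint A))
      (fun A => ContinuousLinearMap.opNorm_le_bound _ (norm_nonneg _) fun B => ?_)
      (fun A B => by simp only [map_sub])
    rw [mul_comm, ← ContinuousLinearMap.adjoint.norm_map A]
    exact ContinuousLinearMap.opNorm_comp_le B _
  obtain ⟨B, δ, hB, hδ, hL⟩ := hkL.exists_riemannSum_bounds hC hη hαη ht.1
  obtain ⟨B', δ', hB', hδ', hR⟩ := hkR.exists_riemannSum_bounds hC hη hαη ht'.1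
  set kL : ℝ → (H →L[ℝ] H) →L[ℝ] (H →L[ℝ] H) :=
    fun u => ContinuousLinearMap.compL ℝ H H H (K τ u) with hkL_def
  set kR : ℝ → (H →L[ℝ] H) →L[ℝ] (H →L[ℝ] H) :=
    fun u => (ContinuousLinearMap.compL ℝ H H H).flip (ContinuousLinearMap.adjoint (K τ' u))
    with hkR_def
  have hincr : ∀ r s, 0 ≤ r → r ≤ s → s ≤ t →
      HolderBound (|D| * (s - r) ^ α) α t' (fun x => Q s x - Q r x) := by
    intro r s h0 hrs hst r' s' h0' hrs' hst'
    have h := hD s r s' r' h0 hrs (hst.trans (ht.2.trans hτ.2)) h0' hrs'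
      (hst'.trans (ht'.2.trans hτ'.2))
    rw [Real.mul_rpow (by linarith) (by linarith), ← mul_assoc] at h
    have e : rectIncrement Q r r' s s' = Q s s' - Q r s' - (Q s r' - Q r r') := by
      simp only [rectIncrement]; abel
    rw [e] at h
    have hp : 0 ≤ (s - r) ^ α := Real.rpow_nonneg (by linarith) _
    have hp' : 0 ≤ (s' - r') ^ α := Real.rpow_nonneg (by linarith) _
    refine h.trans ?_
    gcongr
    exact le_abs_self D
  have hnn : ∀ r s : ℝ, r ≤ s → 0 ≤ |D| * (s - r) ^ α := fun r s h =>
    mul_nonneg (abs_nonneg D) (Real.rpow_nonneg (by linarith) _)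
  have hG : ∀ R : IntervalPartition 0 t',
      HolderBound (B' * |D|) α t (fun s => riemannSum kR (Q s) R) := by
    intro R r s h0 hrs hst
    rw [← riemannSum_sub]
    refine ((hR _ _ (hnn r s hrs) (hincr r s h0 hrs hst)).1 R).trans_eq ?_
    ring
  have hGd : ∀ R R' : IntervalPartition 0 t',
      HolderBound (|D| * (B' * (R.mesh : ℝ) ^ δ' + B' * (R'.mesh : ℝ) ^ δ')) α t
        (fun s => riemannSum kR (Q s) R - riemannSum kR (Q s) R') := by
    intro R R' r s h0 hrs hst
    rw [sub_sub_sub_comm, ← riemannSum_sub, ← riemannSum_sub]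
    refine ((hR _ _ (hnn r s hrs) (hincr r s h0 hrs hst)).2 R R').trans_eq ?_
    ring
  have := meshFilter_neBot ht.1
  have := meshFilter_neBot ht'.1
  have he : Tendsto (fun p : IntervalPartition 0 t × IntervalPartition 0 t' =>
      B' * |D| * (B * (p.1.mesh : ℝ) ^ δ) + B * |D| * (B' * (p.2.mesh : ℝ) ^ δ'))
      (meshFilter 0 t ×ˢ meshFilter 0 t') (𝓝 0) := by
    have h1 := ((tendsto_mesh_rpow (t := t) (B := B) hδ).comp
      (tendsto_fst (g := meshFilter 0 t'))).const_mul (B' * |D|)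
    have h2 := ((tendsto_mesh_rpow (t := t') (B := B') hδ').comp
      (tendsto_snd (f := meshFilter 0 t))).const_mul (B * |D|)
    simpa using h1.add h2
  refine tendsto_limUnder_of_norm_sub_le he fun p p' => ?_
  rw [volterraSum₂_eq_riemannSum, volterraSum₂_eq_riemannSum]
  have h1 := (hL _ _ (by positivity) (hG p.2)).2 p.1 p'.1
  have h2 := (hL _ _ (by positivity) (hGd p.2 p'.2)).1 p'.1
  rw [riemannSum_sub] at h2
  refine (norm_sub_le_norm_sub_add_norm_sub _ _ _).trans ((add_le_add h1 h2).trans_eq ?_)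
  ring

end Existence

/-! ### Almost sure limits of Gaussian random variables -/

section GaussianLimits

variable {Ω : Type*} [MeasurableSpace Ω] {P : Measure Ω} [IsProbabilityMeasure P]

/-- An almost sure limit of centred real Gaussian variables with convergent variances is a centred
Gaussian variable, whose variance is the limit. -/
theorem map_eq_gaussianReal_of_tendsto {Y : ℕ → Ω → ℝ} {Z : Ω → ℝ} {v : ℝ}
    (hY : ∀ n, HasGaussianLaw (Y n) P) (h0 : ∀ n, ∫ ω, Y n ω ∂P = 0)
    (hlim : ∀ᵐ ω ∂P, Tendsto (fun n => Y n ω) atTop (𝓝 (Z ω)))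
    (hv : Tendsto (fun n => ∫ ω, Y n ω ^ 2 ∂P) atTop (𝓝 v)) :
    P.map Z = gaussianReal 0 v.toNNReal := by
  have hZ : AEMeasurable Z P :=
    aemeasurable_of_tendsto_metrizable_ae atTop (fun n => (hY n).aemeasurable) hlim
  have hv0 : 0 ≤ v := ge_of_tendsto' hv fun n => integral_nonneg fun ω => sq_nonneg _
  have := Measure.isProbabilityMeasure_map hZ
  refine Measure.ext_of_charFun (funext fun t => ?_)
  have hcf : ∀ X : Ω → ℝ, AEMeasurable X P →
      charFun (P.map X) t = ∫ ω, Complex.exp (t * X ω * Complex.I) ∂P := by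
    intro X hX
    rw [charFun_apply_real, integral_map hX (by fun_prop)]
  have hlim1 : Tendsto (fun n => charFun (P.map (Y n)) t) atTop (𝓝 (charFun (P.map Z) t)) := by
    rw [hcf Z hZ]
    simp_rw [fun n => hcf (Y n) (hY n).aemeasurable]
    refine tendsto_integral_of_dominated_convergence (fun _ => 1) (fun n => ?_)
      (integrable_const 1) (fun n => ae_of_all _ fun ω => ?_) ?_
    · have := (hY n).aemeasurable
      exact AEMeasurable.aestronglyMeasurable (by fun_prop)
    · rw [← Complex.ofReal_mul, Complex.norm_exp_ofReal_mul_I]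
    · filter_upwards [hlim] with ω hω
      have h1 : Tendsto (fun n => ((Y n ω : ℝ) : ℂ)) atTop (𝓝 (Z ω : ℂ)) :=
        (Complex.continuous_ofReal.tendsto _).comp hω
      exact ((h1.const_mul (t : ℂ)).mul_const Complex.I).cexp
  have hlim2 : Tendsto (fun n => charFun (P.map (Y n)) t) atTop
      (𝓝 (charFun (gaussianReal 0 v.toNNReal) t)) := by
    have e : ∀ n, charFun (P.map (Y n)) t =
        Complex.exp (-(((∫ ω, Y n ω ^ 2 ∂P : ℝ) : ℂ) * t ^ 2 / 2)) := by
      intro n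
      have hvar := variance_of_integral_eq_zero (hY n).aemeasurable (h0 n)
      rw [(hY n).map_eq_gaussianReal, h0 n, hvar, charFun_gaussianReal,
        Real.coe_toNNReal _ (integral_nonneg fun ω => sq_nonneg _)]
      simp
    simp_rw [e]
    rw [charFun_gaussianReal, Real.coe_toNNReal _ hv0]
    have h1 : Tendsto (fun n => ((∫ ω, Y n ω ^ 2 ∂P : ℝ) : ℂ)) atTop (𝓝 (v : ℂ)) :=
      (Complex.continuous_ofReal.tendsto _).comp hv
    simpa using (((h1.mul_const ((t : ℂ) ^ 2)).div_const 2).neg).cexp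
  exact tendsto_nhds_unique hlim1 hlim2

theorem integral_eq_zero_and_sq_eq_of_tendsto {Y : ℕ → Ω → ℝ} {Z : Ω → ℝ} {v : ℝ}
    (hY : ∀ n, HasGaussianLaw (Y n) P) (h0 : ∀ n, ∫ ω, Y n ω ∂P = 0)
    (hlim : ∀ᵐ ω ∂P, Tendsto (fun n => Y n ω) atTop (𝓝 (Z ω)))
    (hv : Tendsto (fun n => ∫ ω, Y n ω ^ 2 ∂P) atTop (𝓝 v)) :
    ∫ ω, Z ω ∂P = 0 ∧ ∫ ω, Z ω ^ 2 ∂P = v := by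
  have hZ : AEMeasurable Z P :=
    aemeasurable_of_tendsto_metrizable_ae atTop (fun n => (hY n).aemeasurable) hlim
  have hv0 : 0 ≤ v := ge_of_tendsto' hv fun n => integral_nonneg fun ω => sq_nonneg _
  have h := map_eq_gaussianReal_of_tendsto hY h0 hlim hv
  have h1 : ∫ ω, Z ω ∂P = 0 := by
    rw [← integral_map (f := fun x : ℝ => x) hZ (by fun_prop), h, integral_id_gaussianReal]
  refine ⟨h1, ?_⟩
  have h2 := variance_of_integral_eq_zero hZ h1
  rw [← variance_id_map hZ, h, variance_id_gaussianReal, Real.coe_toNNReal _ hv0] at h2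
  exact h2.symm

variable {E : Type*} [NormedAddCommGroup E] [NormedSpace ℝ E] [CompleteSpace E]
  [SecondCountableTopology E] [MeasurableSpace E] [BorelSpace E]

/-- Almost sure limits of centred Gaussian variables in a separable Banach space, for which the
second moments of all continuous functionals converge, are centred Gaussian, and the mixed second
moments of continuous functionals converge to those of the limit. -/
theorem hasGaussianLaw_of_tendsto {Z : ℕ → Ω → E} {X : Ω → E}
    (hZ : ∀ n, HasGaussianLaw (Z n) P) (h0 : ∀ n, ∫ ω, Z n ω ∂P = 0)
    (hlim : ∀ᵐ ω ∂P, Tendsto (fun n => Z n ω) atTop (𝓝 (X ω)))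
    (hv : ∀ L : StrongDual ℝ E, ∃ v, Tendsto (fun n => ∫ ω, L (Z n ω) ^ 2 ∂P) atTop (𝓝 v)) :
    HasGaussianLaw X P ∧ ∫ ω, X ω ∂P = 0 ∧ ∀ L M : StrongDual ℝ E,
      Tendsto (fun n => ∫ ω, L (Z n ω) * M (Z n ω) ∂P) atTop (𝓝 (∫ ω, L (X ω) * M (X ω) ∂P)) := by
  have hX : AEMeasurable X P :=
    aemeasurable_of_tendsto_metrizable_ae atTop (fun n => (hZ n).aemeasurable) hlim
  have hLZ : ∀ (L : StrongDual ℝ E) n, HasGaussianLaw (fun ω => L (Z n ω)) P :=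
    fun L n => (hZ n).map_fun L
  have hL0 : ∀ (L : StrongDual ℝ E) n, ∫ ω, L (Z n ω) ∂P = 0 := fun L n => by
    rw [L.integral_comp_comm (hZ n).integrable, h0 n, map_zero]
  have hLlim : ∀ L : StrongDual ℝ E,
      ∀ᵐ ω ∂P, Tendsto (fun n => L (Z n ω)) atTop (𝓝 (L (X ω))) := fun L => by
    filter_upwards [hlim] with ω hω using (L.continuous.tendsto _).comp hω
  have hG : HasGaussianLaw X P := by
    refine ⟨isGaussian_of_map_eq_gaussianReal fun L => ?_⟩
    obtain ⟨v, hv⟩ := hv L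
    refine ⟨0, v.toNNReal, ?_⟩
    rw [AEMeasurable.map_map_of_aemeasurable (by fun_prop) hX]
    exact map_eq_gaussianReal_of_tendsto (hLZ L) (hL0 L) (hLlim L) hv
  have hsq : ∀ L : StrongDual ℝ E, Tendsto (fun n => ∫ ω, L (Z n ω) ^ 2 ∂P) atTop
      (𝓝 (∫ ω, L (X ω) ^ 2 ∂P)) := by
    intro L
    obtain ⟨v, hv⟩ := hv L
    rw [(integral_eq_zero_and_sq_eq_of_tendsto (hLZ L) (hL0 L) (hLlim L) hv).2]
    exact hv
  refine ⟨hG, ?_, fun L M => ?_⟩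
  · refine SeparatingDual.eq_zero_of_forall_dual_eq_zero (R := ℝ) fun L => ?_
    obtain ⟨v, hv⟩ := hv L
    rw [← L.integral_comp_comm hG.integrable]
    exact (integral_eq_zero_and_sq_eq_of_tendsto (hLZ L) (hL0 L) (hLlim L) hv).1
  · have hpol : ∀ Y : Ω → E, HasGaussianLaw Y P → ∫ ω, L (Y ω) * M (Y ω) ∂P =
        (∫ ω, (L + M) (Y ω) ^ 2 ∂P - ∫ ω, L (Y ω) ^ 2 ∂P - ∫ ω, M (Y ω) ^ 2 ∂P) / 2 := by
      intro Y hY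
      have hi : ∀ N : StrongDual ℝ E, Integrable (fun ω => N (Y ω) ^ 2) P :=
        fun N => (hY.map_fun N).memLp_two.integrable_sq
      have h1 := integral_sub (hi (L + M)) (hi L)
      have h2 := integral_sub ((hi (L + M)).sub (hi L)) (hi M)
      simp only [Pi.sub_apply] at h2
      rw [← h1, ← h2, ← integral_div]
      refine integral_congr_ae (ae_of_all _ fun ω => ?_)
      simp only [add_apply]
      ring
    simp_rw [fun n => hpol (Z n) (hZ n)]
    rw [hpol X hG]
    exact (((hsq (L + M)).sub (hsq L)).sub (hsq M)).div_const 2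

end GaussianLimits

/-! ### Covariance operators -/

section Covariance

variable {Ω : Type*} [MeasurableSpace Ω] {P : Measure Ω}
  {H : Type*} [NormedAddCommGroup H] [InnerProductSpace ℝ H]

theorem integrable_rankOne {X Y : Ω → H} (hX : MemLp X 2 P) (hY : MemLp Y 2 P) :
    Integrable (fun ω => InnerProductSpace.rankOne ℝ (X ω) (Y ω)) P := by
  have hi : Integrable (fun ω => ‖X ω‖ * ‖Y ω‖) P := hX.norm.integrable_mul hY.norm
  refine hi.mono' ?_ (ae_of_all _ fun ω => (InnerProductSpace.norm_rankOne _ _).le)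
  have hc : Continuous fun p : H × H => InnerProductSpace.rankOne ℝ p.1 p.2 :=
    ((InnerProductSpace.rankOne ℝ).continuous.comp continuous_fst).clm_apply continuous_snd
  exact hc.comp_aestronglyMeasurable (f := fun ω => (X ω, Y ω)) (hX.1.prodMk hY.1)

theorem inner_covarianceOp_apply [CompleteSpace H] {X Y : Ω → H} (hX : MemLp X 2 P)
    (hY : MemLp Y 2 P) (f g : H) :
    ⟪f, covarianceOp P X Y g⟫_ℝ = ∫ ω, ⟪f, X ω⟫_ℝ * ⟪g, Y ω⟫_ℝ ∂P := by
  let φ : (H →L[ℝ] H) →L[ℝ] ℝ := innerSL ℝ f ∘L ContinuousLinearMap.apply ℝ H g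
  have h : φ (covarianceOp P X Y) = ∫ ω, φ (InnerProductSpace.rankOne ℝ (X ω) (Y ω)) ∂P :=
    (φ.integral_comp_comm (integrable_rankOne hX hY)).symm
  refine h.trans (integral_congr_ae (ae_of_all _ fun ω => ?_))
  change ⟪f, ⟪Y ω, g⟫_ℝ • X ω⟫_ℝ = _
  rw [inner_smul_right, real_inner_comm g, mul_comm]

/-- The covariance operator of two increments is the rectangular increment of the covariance
operator. -/
theorem integral_inner_sub_mul_inner_sub [CompleteSpace H] {X X' Y Y' : Ω → H} (hX : MemLp X 2 P)
    (hX' : MemLp X' 2 P) (hY : MemLp Y 2 P) (hY' : MemLp Y' 2 P) (f g : H) :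
    ∫ ω, ⟪f, X' ω - X ω⟫_ℝ * ⟪g, Y' ω - Y ω⟫_ℝ ∂P =
      ⟪f, (covarianceOp P X' Y' - covarianceOp P X Y' - covarianceOp P X' Y +
        covarianceOp P X Y) g⟫_ℝ := by
  have hi : ∀ {U V : Ω → H}, MemLp U 2 P → MemLp V 2 P →
      Integrable (fun ω => ⟪f, U ω⟫_ℝ * ⟪g, V ω⟫_ℝ) P := fun hU hV =>
    (hU.const_inner f).integrable_mul (hV.const_inner g)
  simp only [add_apply, sub_apply, inner_add_right, inner_sub_right]
  rw [inner_covarianceOp_apply hX' hY', inner_covarianceOp_apply hX hY',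
    inner_covarianceOp_apply hX' hY, inner_covarianceOp_apply hX hY]
  have h1 := integral_sub (hi hX' hY') (hi hX hY')
  have h2 := integral_sub ((hi hX' hY').sub (hi hX hY')) (hi hX' hY)
  have h3 := integral_add (((hi hX' hY').sub (hi hX hY')).sub (hi hX' hY)) (hi hX hY)
  simp only [Pi.sub_apply] at h2 h3
  rw [← h1, ← h2, ← h3]
  refine integral_congr_ae (ae_of_all _ fun ω => ?_)
  simp only
  ring

end Covariance

/-! ### Riemann sums of a Gaussian process -/

section GaussianRiemannSums

variable {Ω : Type*} [MeasurableSpace Ω] {P : Measure Ω} {H : Type*} [NormedAddCommGroup H]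
  [InnerProductSpace ℝ H] [SecondCountableTopology H] [MeasurableSpace H] [BorelSpace H]
  {T : ℝ} {W : ℝ → Ω → H}

theorem isGaussianProcess_volterraSum (hW : IsGaussianProcess (fun t : Icc (0 : ℝ) T => W t) P)
    (K : ℝ → ℝ → H →L[ℝ] H) {S : Type*} (τ t : S → ℝ) (ht : ∀ s, t s ∈ Icc 0 T)
    (p : ∀ s, IntervalPartition 0 (t s)) :
    IsGaussianProcess (fun s ω => volterraSum K (fun u => W u ω) (τ s) (t s) (p s)) P := by
  classical
  refine hW.of_isGaussianProcess fun s => ?_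
  have hT : (0 : ℝ) ≤ T := (ht s).1.trans (ht s).2
  -- the partition points as elements of the index set `[0, T]`
  let q : ℕ → Icc (0 : ℝ) T := fun i => projIcc 0 T hT ((p s).pt i)
  have hq : ∀ i ≤ (p s).n, (q i : ℝ) = (p s).pt i := fun i hi =>
    congrArg Subtype.val
      (projIcc_of_mem hT ⟨(p s).le_pt hi, ((p s).pt_le hi).trans (ht s).2⟩)
  let I : Finset (Icc (0 : ℝ) T) := (Finset.range ((p s).n + 1)).image q
  have hI : ∀ i ≤ (p s).n, q i ∈ I := fun i hi =>
    Finset.mem_image_of_mem q (Finset.mem_range.2 (by omega))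
  let e : Icc (0 : ℝ) T → (I → H) →L[ℝ] H := fun x =>
    if h : x ∈ I then ContinuousLinearMap.proj (⟨x, h⟩ : I) else 0
  refine ⟨I, ∑ i ∈ Finset.range (p s).n,
    K (τ s) ((p s).pt i) ∘L (e (q (i + 1)) - e (q i)), fun ω => ?_⟩
  have he : ∀ i ≤ (p s).n, e (q i) (I.restrict fun x => W x ω) = W ((p s).pt i) ω := by
    intro i hi
    simp only [e, dif_pos (hI i hi), ContinuousLinearMap.proj_apply, Finset.restrict, hq i hi]
  rw [sum_apply]
  refine Finset.sum_congr rfl fun i hi => ?_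
  have hi' := Finset.mem_range.1 hi
  rw [ContinuousLinearMap.comp_apply, sub_apply, he (i + 1) hi', he i hi'.le]

theorem integral_volterraSum [CompleteSpace H]
    (hW : IsGaussianProcess (fun t : Icc (0 : ℝ) T => W t) P)
    (hmean : ∀ t ∈ Icc (0 : ℝ) T, ∫ ω, W t ω ∂P = 0) (K : ℝ → ℝ → H →L[ℝ] H) (τ : ℝ) {t : ℝ}
    (ht : t ∈ Icc 0 T) (p : IntervalPartition 0 t) :
    ∫ ω, volterraSum K (fun u => W u ω) τ t p ∂P = 0 := by
  have hmem : ∀ i ≤ p.n, p.pt i ∈ Icc 0 T := fun i hi => ⟨p.le_pt hi, (p.pt_le hi).trans ht.2⟩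
  have hint : ∀ s ∈ Icc 0 T, Integrable (W s) P := fun s hs =>
    (hW.hasGaussianLaw_eval ⟨s, hs⟩).integrable
  have hd : ∀ i ∈ Finset.range p.n,
      Integrable (fun ω => W (p.pt (i + 1)) ω - W (p.pt i) ω) P := fun i hi =>
    (hint _ (hmem _ (Finset.mem_range.1 hi))).sub (hint _ (hmem _ (Finset.mem_range.1 hi).le))
  simp only [volterraSum]
  rw [integral_finsetSum _ fun i hi => (K τ (p.pt i)).integrable_comp (hd i hi)]
  refine Finset.sum_eq_zero fun i hi => ?_
  rw [(K τ (p.pt i)).integral_comp_comm (hd i hi)]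
  have hi' := Finset.mem_range.1 hi
  rw [integral_sub (hint _ (hmem _ hi')) (hint _ (hmem _ hi'.le)), hmean _ (hmem _ hi'),
    hmean _ (hmem _ hi'.le), sub_self, map_zero]

/-- The covariances of the Riemann sums of `W` are the two-dimensional Riemann sums of its
covariance operator. -/
theorem integral_inner_volterraSum_mul_inner_volterraSum [CompleteSpace H]
    (hW : IsGaussianProcess (fun t : Icc (0 : ℝ) T => W t) P) (K : ℝ → ℝ → H →L[ℝ] H)
    {QW : ℝ → ℝ → H →L[ℝ] H}
    (hQW : ∀ s ∈ Icc (0 : ℝ) T, ∀ t ∈ Icc (0 : ℝ) T, QW s t = covarianceOp P (W s) (W t))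
    (τ τ' : ℝ) {t t' : ℝ} (ht : t ∈ Icc 0 T) (ht' : t' ∈ Icc 0 T)
    (p : IntervalPartition 0 t) (p' : IntervalPartition 0 t') (f g : H) :
    ∫ ω, ⟪f, volterraSum K (fun u => W u ω) τ t p⟫_ℝ *
        ⟪g, volterraSum K (fun u => W u ω) τ' t' p'⟫_ℝ ∂P =
      ⟪f, volterraSum₂ K QW τ τ' t t' (p, p') g⟫_ℝ := by
  have hmem : ∀ i ≤ p.n, p.pt i ∈ Icc 0 T := fun i hi => ⟨p.le_pt hi, (p.pt_le hi).trans ht.2⟩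
  have hmem' : ∀ i ≤ p'.n, p'.pt i ∈ Icc 0 T := fun i hi =>
    ⟨p'.le_pt hi, (p'.pt_le hi).trans ht'.2⟩
  have hL2 : ∀ s ∈ Icc 0 T, MemLp (W s) 2 P := fun s hs =>
    (hW.hasGaussianLaw_eval ⟨s, hs⟩).memLp_two
  simp only [volterraSum, inner_sum, ← ContinuousLinearMap.adjoint_inner_left,
    Finset.sum_mul_sum, volterraSum₂, sum_apply]
  have hint : ∀ i ∈ Finset.range p.n, ∀ j ∈ Finset.range p'.n, Integrable (fun ω =>
      ⟪ContinuousLinearMap.adjoint (K τ (p.pt i)) f, W (p.pt (i + 1)) ω - W (p.pt i) ω⟫_ℝ *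
      ⟪ContinuousLinearMap.adjoint (K τ' (p'.pt j)) g,
        W (p'.pt (j + 1)) ω - W (p'.pt j) ω⟫_ℝ) P := by
    intro i hi j hj
    have hi' := Finset.mem_range.1 hi
    have hj' := Finset.mem_range.1 hj
    exact (((hL2 _ (hmem _ hi')).sub (hL2 _ (hmem _ hi'.le))).const_inner _).integrable_mul
      (((hL2 _ (hmem' _ hj')).sub (hL2 _ (hmem' _ hj'.le))).const_inner _)
  rw [integral_finsetSum _ fun i hi => integrable_finsetSum _ (hint i hi)]
  refine Finset.sum_congr rfl fun i hi => ?_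
  rw [integral_finsetSum _ (hint i hi)]
  refine Finset.sum_congr rfl fun j hj => ?_
  have hi' := Finset.mem_range.1 hi
  have hj' := Finset.mem_range.1 hj
  rw [ContinuousLinearMap.adjoint_inner_left, ContinuousLinearMap.comp_apply,
    ContinuousLinearMap.comp_apply,
    integral_inner_sub_mul_inner_sub (hL2 _ (hmem _ hi'.le)) (hL2 _ (hmem _ hi'))
    (hL2 _ (hmem' _ hj'.le)) (hL2 _ (hmem' _ hj')), ContinuousLinearMap.adjoint_inner_left,
    rectIncrement, hQW _ (hmem _ hi') _ (hmem' _ hj'), hQW _ (hmem _ hi'.le) _ (hmem' _ hj'),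
    hQW _ (hmem _ hi') _ (hmem' _ hj'.le), hQW _ (hmem _ hi'.le) _ (hmem' _ hj'.le)]

end GaussianRiemannSums

/-! ### The Gaussian Volterra process -/

section VolterraProcess

variable {Ω : Type*} [MeasurableSpace Ω] {P : Measure Ω} [IsProbabilityMeasure P]
  {H : Type*} [NormedAddCommGroup H] [InnerProductSpace ℝ H] [CompleteSpace H]
  [SecondCountableTopology H] [MeasurableSpace H] [BorelSpace H]

/-- The index set of the process `X^τ(t)`: the pairs `(τ, t)` with `0 ≤ t ≤ τ ≤ T`. -/
abbrev Simplex (T : ℝ) : Type := {p : ℝ × ℝ // p.1 ∈ Icc (0 : ℝ) T ∧ p.2 ∈ Icc (0 : ℝ) p.1}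

/-- The Volterra process in both parameters is a centred Gaussian process, and its covariances are
two-dimensional Volterra integrals: all this passes to the limit along Riemann sums. -/
theorem isGaussianProcess_pathwiseVolterra {T α η : ℝ} {β : ℝ≥0} (hη : 0 < η) (hβη : η < β)
    (hαη : η < α) {W : ℝ → Ω → H} (hW : IsGaussianProcess (fun t : Icc (0 : ℝ) T => W t) P)
    (hmean : ∀ t ∈ Icc (0 : ℝ) T, ∫ ω, W t ω ∂P = 0)
    (hHolder : ∀ᵐ ω ∂P, ∃ C : ℝ≥0, HolderOnWith C β (fun t => W t ω) (Icc 0 T))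
    {K : ℝ → ℝ → H →L[ℝ] H} (hK : IsVolterraKernel T η K) {QW : ℝ → ℝ → H →L[ℝ] H}
    (hQW : ∀ s ∈ Icc (0 : ℝ) T, ∀ t ∈ Icc (0 : ℝ) T, QW s t = covarianceOp P (W s) (W t))
    (hQ : IsRegularCovariance T α QW) :
    IsGaussianProcess (fun s : Simplex T => pathwiseVolterra K W s.1.1 s.1.2) P ∧
    (∀ s : Simplex T, ∫ ω, pathwiseVolterra K W s.1.1 s.1.2 ω ∂P = 0) ∧
    ∀ (s s' : Simplex T) (f g : H),
      ∫ ω, ⟪f, pathwiseVolterra K W s.1.1 s.1.2 ω⟫_ℝ *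
          ⟪g, pathwiseVolterra K W s'.1.1 s'.1.2 ω⟫_ℝ ∂P =
        ⟪f, volterraIntegral₂ K QW s.1.1 s'.1.1 s.1.2 s'.1.2 g⟫_ℝ := by
  classical
  have hmem : ∀ s : Simplex T, s.1.2 ∈ Icc 0 T := fun s =>
    ⟨s.2.2.1, s.2.2.2.trans s.2.1.2⟩
  let p : ∀ (n : ℕ) (s : Simplex T), IntervalPartition 0 s.1.2 := fun n s =>
    uniformPartition s.1.2 s.2.2.1 n
  let X : Simplex T → Ω → H := fun s => pathwiseVolterra K W s.1.1 s.1.2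
  let Y : ℕ → Simplex T → Ω → H := fun n s ω =>
    volterraSum K (fun u => W u ω) s.1.1 s.1.2 (p n s)
  have hYG : ∀ n, IsGaussianProcess (Y n) P := fun n =>
    isGaussianProcess_volterraSum hW K (fun s : Simplex T => s.1.1) (fun s => s.1.2) hmem (p n)
  have hY0 : ∀ n s, ∫ ω, Y n s ω ∂P = 0 := fun n s =>
    integral_volterraSum hW hmean K _ (hmem s) (p n s)
  have hYlim : ∀ᵐ ω ∂P, ∀ s, Tendsto (fun n => Y n s ω) atTop (𝓝 (X s ω)) := by
    filter_upwards [hHolder] with ω ⟨C, hC⟩ s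
    exact (tendsto_volterraSum hη hβη hK hC s.2.1 s.2.2).comp
      (tendsto_uniformPartition s.1.2 s.2.2.1)
  have hYcov : ∀ s s' f g, Tendsto (fun n => ∫ ω, ⟪f, Y n s ω⟫_ℝ * ⟪g, Y n s' ω⟫_ℝ ∂P) atTop
      (𝓝 ⟪f, volterraIntegral₂ K QW s.1.1 s'.1.1 s.1.2 s'.1.2 g⟫_ℝ) := by
    intro s s' f g
    simp only [Y, fun n => integral_inner_volterraSum_mul_inner_volterraSum hW K hQW s.1.1 s'.1.1
      (hmem s) (hmem s') (p n s) (p n s') f g]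
    have h := (tendsto_volterraSum₂ hη hαη hK hQ s.2.1 s.2.2 s'.2.1 s'.2.2).comp
      ((tendsto_uniformPartition s.1.2 s.2.2.1).prodMk
        (tendsto_uniformPartition s'.1.2 s'.2.2.1))
    exact (tendsto_const_nhds (x := f)).inner
      (((ContinuousLinearMap.apply ℝ H g).continuous.tendsto _).comp h)
  have main : ∀ I : Finset (Simplex T), HasGaussianLaw (fun ω => I.restrict (X · ω)) P ∧
      ∫ ω, I.restrict (X · ω) ∂P = 0 ∧ ∀ L M : StrongDual ℝ (I → H),
      Tendsto (fun n => ∫ ω, L (I.restrict (Y n · ω)) * M (I.restrict (Y n · ω)) ∂P) atTop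
        (𝓝 (∫ ω, L (I.restrict (X · ω)) * M (I.restrict (X · ω)) ∂P)) := by
    intro I
    refine hasGaussianLaw_of_tendsto (fun n => (hYG n).hasGaussianLaw I) (fun n => ?_) ?_
      fun L => ?_
    · ext i
      have h := (ContinuousLinearMap.proj (R := ℝ) (φ := fun _ : I => H) i).integral_comp_comm
        ((hYG n).hasGaussianLaw I).integrable
      exact h.symm.trans (hY0 n i)
    · filter_upwards [hYlim] with ω hω
      exact tendsto_pi_nhds.2 fun i => hω i
    · -- represent the functional by vectors, one for each index
      let F : I → H := fun i => (InnerProductSpace.toDual ℝ H).symm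
        (L ∘L ContinuousLinearMap.single ℝ (fun _ : I => H) i)
      have hF : ∀ x : I → H, L x = ∑ i, ⟪F i, x i⟫_ℝ := by
        intro x
        rw [← L.sum_comp_single (v := x)]
        refine Finset.sum_congr rfl fun i _ => ?_
        rw [InnerProductSpace.toDual_symm_apply]
      refine ⟨∑ i : I, ∑ j : I, ⟪F i, volterraIntegral₂ K QW i.1.1.1 j.1.1.1 i.1.1.2 j.1.1.2
        (F j)⟫_ℝ, ?_⟩
      have hsum : ∀ n, ∫ ω, L (I.restrict (Y n · ω)) ^ 2 ∂P =
          ∑ i : I, ∑ j : I, ∫ ω, ⟪F i, Y n i ω⟫_ℝ * ⟪F j, Y n j ω⟫_ℝ ∂P := by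
        intro n
        have hint : ∀ i j : I, Integrable (fun ω => ⟪F i, Y n i ω⟫_ℝ * ⟪F j, Y n j ω⟫_ℝ) P :=
          fun i j => (((hYG n).hasGaussianLaw_eval i).memLp_two.const_inner _).integrable_mul
            (((hYG n).hasGaussianLaw_eval j).memLp_two.const_inner _)
        simp_rw [hF, sq, Finset.sum_mul_sum, Finset.restrict]
        rw [integral_finsetSum _ fun i _ => integrable_finsetSum _ fun j _ => hint i j]
        exact Finset.sum_congr rfl fun i _ => integral_finsetSum _ fun j _ => hint i j
      simp_rw [hsum]
      exact tendsto_finsetSum _ fun i _ => tendsto_finsetSum _ fun j _ => hYcov i j _ _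
  have hG : IsGaussianProcess X P := ⟨fun I => (main I).1⟩
  refine ⟨hG, fun s => ?_, fun s s' f g => ?_⟩
  · have h := (ContinuousLinearMap.proj (R := ℝ) (φ := fun _ : ({s} : Finset (Simplex T)) => H)
      ⟨s, by simp⟩).integral_comp_comm (main {s}).1.integrable
    rw [(main {s}).2.1, map_zero] at h
    exact h
  · have h := (main {s, s'}).2.2
      (innerSL ℝ f ∘L ContinuousLinearMap.proj (⟨s, by simp⟩ : ({s, s'} : Finset (Simplex T))))
      (innerSL ℝ g ∘L ContinuousLinearMap.proj (⟨s', by simp⟩ : ({s, s'} : Finset (Simplex T))))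
    exact tendsto_nhds_unique h (hYcov s s' f g)

end VolterraProcess

end GaussianVolterra

theorem proposition4p5
    {Ω : Type*} [MeasurableSpace Ω] (P : Measure Ω) [IsProbabilityMeasure P]
    {H : Type*} [NormedAddCommGroup H] [InnerProductSpace ℝ H] [CompleteSpace H]
    [SecondCountableTopology H] [MeasurableSpace H] [BorelSpace H]
    (T : ℝ) (hT : 0 < T)
    (α η : ℝ) (β : ℝ≥0) (hα : α ∈ Ioo (0 : ℝ) 1) (hη : η ∈ Ioo (0 : ℝ) 1)
    (hβ : (β : ℝ) ∈ Ioo (0 : ℝ) 1) (hβη : 0 < (β : ℝ) - η) (hαη : 0 < α - η)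
    (W : ℝ → Ω → H)
    (hW : IsGaussianProcess (fun t : Icc (0 : ℝ) T => W t) P)
    (hmean : ∀ t ∈ Icc (0 : ℝ) T, ∫ ω, W t ω ∂P = 0)
    (hHolder : ∀ᵐ ω ∂P, ∃ C : ℝ≥0, HolderOnWith C β (fun t => W t ω) (Icc 0 T))
    (K : ℝ → ℝ → H →L[ℝ] H) (hK : GaussianVolterra.IsVolterraKernel T η K)
    (QW : ℝ → ℝ → H →L[ℝ] H)
    (hQW : ∀ s ∈ Icc (0 : ℝ) T, ∀ t ∈ Icc (0 : ℝ) T,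
      QW s t = GaussianVolterra.covarianceOp P (W s) (W t))
    (hQ : GaussianVolterra.IsRegularCovariance T α QW) :
    -- the pathwise integrals exist along every Hölder continuous path
    (∀ ω, (∃ C : ℝ≥0, HolderOnWith C β (fun t => W t ω) (Icc 0 T)) →
      ∀ τ ∈ Icc (0 : ℝ) T, ∀ t ∈ Icc (0 : ℝ) τ,
        Tendsto (GaussianVolterra.volterraSum K (fun s => W s ω) τ t)
          (GaussianVolterra.meshFilter 0 t)
          (𝓝 (GaussianVolterra.pathwiseVolterra K W τ t ω))) ∧
    -- the two-dimensional integrals exist in operator norm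
    (∀ τ ∈ Icc (0 : ℝ) T, ∀ t ∈ Icc (0 : ℝ) τ, ∀ τ' ∈ Icc (0 : ℝ) T, ∀ t' ∈ Icc (0 : ℝ) τ',
      Tendsto (GaussianVolterra.volterraSum₂ K QW τ τ' t t')
        (GaussianVolterra.meshFilter 0 t ×ˢ GaussianVolterra.meshFilter 0 t')
        (𝓝 (GaussianVolterra.volterraIntegral₂ K QW τ τ' t t'))) ∧
    -- `t ↦ X^t(t)` is a Gaussian process
    IsGaussianProcess
      (fun t : Icc (0 : ℝ) T => GaussianVolterra.pathwiseVolterra K W (t : ℝ) (t : ℝ)) P ∧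
    -- every `X^τ(t)` is Gaussian with zero mean and the stated characteristic functional
    (∀ τ ∈ Icc (0 : ℝ) T, ∀ t ∈ Icc (0 : ℝ) τ,
      HasGaussianLaw (GaussianVolterra.pathwiseVolterra K W τ t) P ∧
      ∫ ω, GaussianVolterra.pathwiseVolterra K W τ t ω ∂P = 0 ∧
      ∀ f : H,
        ∫ ω, Complex.exp
            (Complex.I * ((⟪GaussianVolterra.pathwiseVolterra K W τ t ω, f⟫_ℝ : ℝ) : ℂ)) ∂P =
          ((Real.exp (-(1 / 2) *
            ⟪GaussianVolterra.volterraIntegral₂ K QW τ τ t t f, f⟫_ℝ) : ℝ) : ℂ)) ∧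
    -- the covariance operators are the two-dimensional Volterra integrals
    (∀ τ ∈ Icc (0 : ℝ) T, ∀ t ∈ Icc (0 : ℝ) τ, ∀ τ' ∈ Icc (0 : ℝ) T, ∀ t' ∈ Icc (0 : ℝ) τ',
      GaussianVolterra.covarianceOp P
          (GaussianVolterra.pathwiseVolterra K W τ t) (GaussianVolterra.pathwiseVolterra K W τ' t') =
        GaussianVolterra.volterraIntegral₂ K QW τ τ' t t') := by
  have hη0 : 0 < η := hη.1
  have hβη' : η < β := by linarith
  have hαη' : η < α := by linarith
  obtain ⟨hG, h0, hcov⟩ := GaussianVolterra.isGaussianProcess_pathwiseVolterra hη0 hβη' hαη' hW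
    hmean hHolder hK hQW hQ
  have hGs : ∀ s : GaussianVolterra.Simplex T,
      HasGaussianLaw (GaussianVolterra.pathwiseVolterra K W s.1.1 s.1.2) P :=
    fun s => hG.hasGaussianLaw_eval s
  refine ⟨fun ω ⟨C, hC⟩ τ hτ t ht =>
      GaussianVolterra.tendsto_volterraSum hη0 hβη' hK hC hτ ht,
    fun τ hτ t ht τ' hτ' t' ht' =>
      GaussianVolterra.tendsto_volterraSum₂ hη0 hαη' hK hQ hτ ht hτ' ht',
    ?_, fun τ hτ t ht => ?_, fun τ hτ t ht τ' hτ' t' ht' => ?_⟩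
  · exact hG.comp_right fun t : Icc (0 : ℝ) T =>
      (⟨((t : ℝ), (t : ℝ)), t.2, t.2.1, le_rfl⟩ : GaussianVolterra.Simplex T)
  · let s : GaussianVolterra.Simplex T := ⟨(τ, t), hτ, ht⟩
    refine ⟨hGs s, h0 s, fun f => ?_⟩
    have hX : HasGaussianLaw (GaussianVolterra.pathwiseVolterra K W τ t) P := hGs s
    have hm : ∫ ω, ⟪f, GaussianVolterra.pathwiseVolterra K W τ t ω⟫_ℝ ∂P = 0 := by
      rw [integral_inner hX.integrable, h0 s, inner_zero_right]
    have hv : Var[fun ω => ⟪f, GaussianVolterra.pathwiseVolterra K W τ t ω⟫_ℝ; P] =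
        ⟪GaussianVolterra.volterraIntegral₂ K QW τ τ t t f, f⟫_ℝ := by
      rw [variance_of_integral_eq_zero (hX.aemeasurable.const_inner (c := f)) hm,
        real_inner_comm, ← hcov s s f f]
      simp only [sq, s]
    have h := hX.charFun_map_eq f
    rw [hm, hv, charFun_apply, integral_map hX.aemeasurable (by fun_prop)] at h
    simp_rw [mul_comm Complex.I]
    rw [h]
    push_cast
    congr 1
    ring
  · refine ContinuousLinearMap.ext fun g => ext_inner_left ℝ fun f => ?_
    rw [GaussianVolterra.inner_covarianceOp_apply (hGs ⟨(τ, t), hτ, ht⟩).memLp_two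
      (hGs ⟨(τ', t'), hτ', ht'⟩).memLp_two]
    exact hcov ⟨(τ, t), hτ, ht⟩ ⟨(τ', t'), hτ', ht'⟩ f g
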